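/- Let $m\ge 1$ and $n>2m$ be integers, and let $\sigma>-2m$ and $p>1$ be real numbers. Call $u$ a distributional solution of $$(-\Delta)^m u=|x|^\sigma u^p\quad\text{in }\mathbb R^n$$ if $u$ is a measurable function with $u\ge 0$ almost everywhere, $u$ not almost everywhere equal to $0$, $u\in L^1_{\rm loc}(\mathbb R^n)$, $|x|^\sigma u^p\in L^1_{\rm loc}(\mathbb R^n)$ and $$\int_{\mathbb R^n}u\,(-\Delta)^m\varphi\,dx=\int_{\mathbb R^n}|x|^\sigma u^p\varphi\,dx\qquad\text{for all }\varphi\in C_0^\infty(\mathbb R^n).$$ Then every distributional solution $u$ satisfies, for almost every $x\in\mathbb R^n$, $$u(x)=C(2m)\int_{\mathbb R^n}\frac{|y|^\sigma u^p(y)}{|x-y|^{n-2m}}\,dy,$$ where the integral converges (absolutely), and $$C(\alpha)=\frac{\Gamma\big(\frac{n-\alpha}{2}\big)}{2^{\alpha}\pi^{n/2}\,\Gamma\big(\frac{\alpha}{2}\big)},\qquad 0<\alpha<n.$$ -/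

import Mathlib

open MeasureTheory
open scoped ContDiff

noncomputable section

/-- The iterated operator `(-Δ)^m` acting on real-valued functions on `ℝⁿ`. -/
def polyLaplacian (n m : ℕ) (φ : EuclideanSpace ℝ (Fin n) → ℝ) :
    EuclideanSpace ℝ (Fin n) → ℝ :=
  (fun f : EuclideanSpace ℝ (Fin n) → ℝ => fun x => -((Laplacian.laplacian f : EuclideanSpace ℝ (Fin n) → ℝ) x))^[m] φ

/-- The right-hand side `|x|^σ u(x)^p` of the Hardy–Hénon equation. -/
def henonSource (n : ℕ) (σ p : ℝ) (u : EuclideanSpace ℝ (Fin n) → ℝ) :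
    EuclideanSpace ℝ (Fin n) → ℝ :=
  fun x => ‖x‖ ^ σ * u x ^ p

/-- `u` is a (non-negative, non-trivial) distributional solution of `(-Δ)^m u = |x|^σ u^p`
in `ℝⁿ`. Functions are regarded up to Lebesgue-null sets. -/
structure IsDistributionalSolution (n m : ℕ) (σ p : ℝ)
    (u : EuclideanSpace ℝ (Fin n) → ℝ) : Prop where
  nonneg : ∀ᵐ x, 0 ≤ u x
  nontrivial : ¬ ∀ᵐ x, u x = 0
  locallyIntegrable : LocallyIntegrable u
  locallyIntegrable_source : LocallyIntegrable (henonSource n σ p u)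
  weak_eq : ∀ φ : EuclideanSpace ℝ (Fin n) → ℝ, ContDiff ℝ ∞ φ → HasCompactSupport φ →
    ∫ x, u x * polyLaplacian n m φ x = ∫ x, henonSource n σ p u x * φ x

/-- The constant `C(α) = Γ((n-α)/2) / (2^α π^{n/2} Γ(α/2))`, for `0 < α < n`. -/
def rieszConst (n : ℕ) (α : ℝ) : ℝ :=
  Real.Gamma ((n - α) / 2) *
    ((2 : ℝ) ^ α * Real.pi ^ ((n : ℝ) / 2) * Real.Gamma (α / 2))⁻¹

end

/-! The equation is tested against bubbles centred at a point `c`. With `τ = a + |x - c|²`, the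
operator `(-Δ)^m` sends `τ^(m - n/2)` to a positive multiple of `a^m τ^(-m - n/2)`
(`radialOp_iterate_bubble`). As `a = ε² → 0` the bubbles increase to the Riesz kernel `|x - c|^(2m -
n)`, while their images form an approximate identity whose mass is the reciprocal of the Riesz
constant. Monotone convergence on the source side and differentiation of the measure `u dx` on the
other give the formula at almost every `c`.

Bubbles lack compact support and are cut off at squared radius `S`. The error is the tail of a
convergent integral plus `O(S^(-n/2))` times the integral of `u` over a ball of radius `√(2S)`, so
it vanishes once `∫_{B_R} u = o(R^n)`. The same growth bound makes the maximal function of `u` at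
`c` finite, hence the image of the bubble integrable against `u`.

The growth bound comes from testing with a high power of a cutoff at scale `S`: a Young-type
inequality absorbs half of the source and bounds the rest. A second use of that inequality turns the
source bound into one of order `S^(n/2 - δ)` for `u`, and `σ > -2m` is exactly what makes `δ`
positive.

All test functions are radial about `c`, so `(-Δ)^m` reduces to iterating an ordinary differential
operator, `radialOp`, on profiles in `τ`. -/

open Set Filter Topology

/-! ### Calculus of the radial profile operator. -/

/-- The operator acting on profiles `F` for which
`-Δ (F (a + ‖x - c‖ ^ 2)) = (radialOp n a F) (a + ‖x - c‖ ^ 2)`. -/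
noncomputable def radialOp (n : ℕ) (a : ℝ) (F : ℝ → ℝ) : ℝ → ℝ :=
  fun t => -(4 * (t - a) * deriv (deriv F) t + 2 * n * deriv F t)

theorem ContDiffOn.deriv_Ioi {F : ℝ → ℝ} (hF : ContDiffOn ℝ ∞ F (Ioi 0)) :
    ContDiffOn ℝ ∞ (deriv F) (Ioi 0) :=
  hF.deriv_of_isOpen isOpen_Ioi (by simp)

theorem ContDiffOn.radialOp {F : ℝ → ℝ} (hF : ContDiffOn ℝ ∞ F (Ioi 0)) (n : ℕ) (a : ℝ) :
    ContDiffOn ℝ ∞ (radialOp n a F) (Ioi 0) := by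
  have h1 := hF.deriv_Ioi
  have h2 := h1.deriv_Ioi
  unfold _root_.radialOp
  fun_prop

theorem ContDiffOn.radialOp_iterate {F : ℝ → ℝ} (hF : ContDiffOn ℝ ∞ F (Ioi 0)) (n : ℕ) (a : ℝ)
    (m : ℕ) : ContDiffOn ℝ ∞ ((_root_.radialOp n a)^[m] F) (Ioi 0) := by
  induction m with
  | zero => exact hF
  | succ m ih => rw [Function.iterate_succ_apply']; exact ih.radialOp n a

theorem Set.EqOn.radialOp {F G : ℝ → ℝ} {U : Set ℝ} (hU : IsOpen U) (h : EqOn F G U)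
    (n : ℕ) (a : ℝ) : EqOn (radialOp n a F) (radialOp n a G) U := by
  intro t ht
  have h1 : EqOn (_root_.deriv F) (_root_.deriv G) U := h.deriv hU
  have h2 : EqOn (_root_.deriv (_root_.deriv F)) (_root_.deriv (_root_.deriv G)) U := h1.deriv hU
  simp only [_root_.radialOp, h1 ht, h2 ht]

theorem Set.EqOn.radialOp_iterate {F G : ℝ → ℝ} {U : Set ℝ} (hU : IsOpen U) (h : EqOn F G U)
    (n : ℕ) (a : ℝ) (m : ℕ) :
    EqOn ((_root_.radialOp n a)^[m] F) ((_root_.radialOp n a)^[m] G) U := by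
  induction m with
  | zero => exact h
  | succ m ih => simp only [Function.iterate_succ_apply']; exact ih.radialOp hU n a

theorem radialOp_const (n : ℕ) (a c : ℝ) : radialOp n a (fun _ => c) = fun _ => 0 := by
  funext t
  simp [radialOp]

theorem radialOp_iterate_zero (n : ℕ) (a : ℝ) (m : ℕ) :
    (radialOp n a)^[m] (fun _ => 0) = fun _ => 0 := by
  induction m with
  | zero => rfl
  | succ m ih => rw [Function.iterate_succ_apply', ih, radialOp_const]

theorem radialOp_iterate_const (n : ℕ) (a c : ℝ) {m : ℕ} (hm : 1 ≤ m) :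
    (radialOp n a)^[m] (fun _ => c) = fun _ => 0 := by
  obtain ⟨m, rfl⟩ : ∃ k, m = k + 1 := ⟨m - 1, by omega⟩
  rw [Function.iterate_succ_apply, radialOp_const, radialOp_iterate_zero]

theorem differentiableAt_of_contDiffOn_Ioi {F : ℝ → ℝ} (hF : ContDiffOn ℝ ∞ F (Ioi 0)) {t : ℝ}
    (ht : 0 < t) : DifferentiableAt ℝ F t :=
  (hF.contDiffAt (Ioi_mem_nhds ht)).differentiableAt (by simp)

theorem radialOp_lincomb {F G : ℝ → ℝ} (hF : ContDiffOn ℝ ∞ F (Ioi 0))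
    (hG : ContDiffOn ℝ ∞ G (Ioi 0)) (n : ℕ) (a b c : ℝ) :
    EqOn (radialOp n a (fun t => b * F t + c * G t))
      (fun t => b * radialOp n a F t + c * radialOp n a G t) (Ioi 0) := by
  have key : ∀ {F G : ℝ → ℝ}, ContDiffOn ℝ ∞ F (Ioi 0) → ContDiffOn ℝ ∞ G (Ioi 0) →
      EqOn (deriv (fun t => b * F t + c * G t)) (fun t => b * deriv F t + c * deriv G t)
        (Ioi 0) := by
    intro F G hF hG t ht
    have h1 := (differentiableAt_of_contDiffOn_Ioi hF ht).hasDerivAt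
    have h2 := (differentiableAt_of_contDiffOn_Ioi hG ht).hasDerivAt
    exact ((h1.const_mul b).add (h2.const_mul c)).deriv
  intro t ht
  have h1 := key hF hG
  have h2 : deriv (deriv fun t => b * F t + c * G t) t = _ :=
    (h1.deriv isOpen_Ioi ht).trans (key hF.deriv_Ioi hG.deriv_Ioi ht)
  simp only [radialOp, h2, h1 ht]
  ring

theorem radialOp_iterate_lincomb {F G : ℝ → ℝ} (hF : ContDiffOn ℝ ∞ F (Ioi 0))
    (hG : ContDiffOn ℝ ∞ G (Ioi 0)) (n : ℕ) (a b c : ℝ) (m : ℕ) :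
    EqOn ((radialOp n a)^[m] (fun t => b * F t + c * G t))
      (fun t => b * (radialOp n a)^[m] F t + c * (radialOp n a)^[m] G t) (Ioi 0) := by
  induction m with
  | zero => exact fun _ _ => rfl
  | succ m ih =>
    simp only [Function.iterate_succ_apply']
    exact (ih.radialOp isOpen_Ioi n a).trans
      (radialOp_lincomb (hF.radialOp_iterate n a m) (hG.radialOp_iterate n a m) n a b c)

/-- Dilating `τ` by `S` also dilates the shift `a`. Scale `S` is thereby reduced to a fixed profile
with shift `a / S`, at the price of one factor `1 / S` per Laplacian. -/
theorem radialOp_comp_div (n : ℕ) (a c : ℝ) {S : ℝ} (hS : S ≠ 0) (F : ℝ → ℝ) :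
    radialOp n a (fun t => c * F (t / S)) = fun t => c / S * radialOp n (a / S) F (t / S) := by
  have key : ∀ (c : ℝ) (F : ℝ → ℝ), deriv (fun t => c * F (t / S)) =
      fun t => c / S * deriv F (t / S) := by
    intro c F
    funext t
    have h := deriv_comp_mul_left S⁻¹ F t
    simp only [smul_eq_mul] at h
    simp only [deriv_const_mul_field, div_eq_inv_mul, h]
    ring
  funext t
  simp only [radialOp, key]
  field_simp

theorem radialOp_iterate_comp_div (n : ℕ) (a c : ℝ) {S : ℝ} (hS : S ≠ 0) (F : ℝ → ℝ) (m : ℕ) :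
    (radialOp n a)^[m] (fun t => c * F (t / S)) =
      fun t => c / S ^ m * (radialOp n (a / S))^[m] F (t / S) := by
  induction m with
  | zero => simp
  | succ m ih =>
    simp only [Function.iterate_succ_apply', ih]
    rw [radialOp_comp_div _ _ _ hS]
    funext t
    rw [pow_succ, div_div]

theorem deriv_pow_succ_mul {h g : ℝ → ℝ} (hh : ContDiffOn ℝ ∞ h (Ioi 0))
    (hg : ContDiffOn ℝ ∞ g (Ioi 0)) (q : ℕ) :
    EqOn (deriv fun t => h t ^ (q + 1) * g t)
      (fun t => h t ^ q * ((q + 1) * deriv h t * g t + h t * deriv g t)) (Ioi 0) := by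
  intro t ht
  have h1 := (differentiableAt_of_contDiffOn_Ioi hh ht).hasDerivAt
  have h2 := (differentiableAt_of_contDiffOn_Ioi hg ht).hasDerivAt
  refine ((h1.pow (q + 1)).mul h2).deriv.trans ?_
  simp only [Nat.add_sub_cancel, Pi.pow_apply]
  push_cast
  ring

/-- Two derivatives cost two powers of `h`. The operator is affine in `a`, so `g₁` and `g₂` can be
chosen independent of `a`; this is what makes the later bounds uniform in `a`. -/
theorem radialOp_pow_mul (n : ℕ) {h g : ℝ → ℝ} (hh : ContDiffOn ℝ ∞ h (Ioi 0))
    (hg : ContDiffOn ℝ ∞ g (Ioi 0)) (q : ℕ) :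
    ∃ g₁ g₂ : ℝ → ℝ, ContDiffOn ℝ ∞ g₁ (Ioi 0) ∧ ContDiffOn ℝ ∞ g₂ (Ioi 0) ∧
      ∀ a, EqOn (radialOp n a fun t => h t ^ (q + 2) * g t)
        (fun t => 1 * (h t ^ q * g₁ t) + a * (h t ^ q * g₂ t)) (Ioi 0) := by
  have hh' := hh.deriv_Ioi
  have hg' := hg.deriv_Ioi
  set k : ℝ → ℝ := fun t => ((q + 1 : ℕ) + 1) * deriv h t * g t + h t * deriv g t with hk
  have hks : ContDiffOn ℝ ∞ k (Ioi 0) := by fun_prop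
  have hks' := hks.deriv_Ioi
  set l : ℝ → ℝ := fun t => (q + 1) * deriv h t * k t + h t * deriv k t with hl
  have hls : ContDiffOn ℝ ∞ l (Ioi 0) := by fun_prop
  refine ⟨fun t => -(4 * t * l t + 2 * n * (h t * k t)), fun t => 4 * l t, by fun_prop,
    by fun_prop, fun a t ht => ?_⟩
  have h1 : EqOn (deriv fun t => h t ^ (q + 2) * g t) (fun t => h t ^ (q + 1) * k t) (Ioi 0) :=
    deriv_pow_succ_mul hh hg (q + 1)
  have h2 : deriv (deriv fun t => h t ^ (q + 2) * g t) t = h t ^ q * l t :=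
    (h1.deriv isOpen_Ioi ht).trans (deriv_pow_succ_mul hh hks q ht)
  simp only [radialOp, h2, h1 ht]
  ring

/-- The surviving factor `|h|^q` lets the Laplacian of a cutoff power be controlled by a smaller
power of the same cutoff. The cofactor `g` is arbitrary because each step of the induction changes
it. -/
theorem exists_radialOp_iterate_pow_mul_bound (n m : ℕ) {h : ℝ → ℝ}
    (hh : ContDiffOn ℝ ∞ h (Ioi 0)) (q : ℕ) :
    ∀ {g : ℝ → ℝ}, ContDiffOn ℝ ∞ g (Ioi 0) →
    ∃ C : ℝ, 0 < C ∧ ∀ a ∈ Icc (0 : ℝ) 1, ∀ t ∈ Icc (1 : ℝ) 2,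
      |(radialOp n a)^[m] (fun t => h t ^ (q + 2 * m) * g t) t| ≤ C * |h t| ^ q := by
  induction m with
  | zero =>
    intro g hg
    have hc : ContinuousOn g (Icc 1 2) :=
      hg.continuousOn.mono fun t ht => lt_of_lt_of_le one_pos ht.1
    obtain ⟨C, hC⟩ := isCompact_Icc.exists_bound_of_continuousOn hc
    refine ⟨|C| + 1, by positivity, fun a _ t ht => ?_⟩
    have := hC t ht
    rw [Real.norm_eq_abs] at this
    simp only [Function.iterate_zero, id, abs_mul, abs_pow, mul_zero, add_zero]
    rw [mul_comm]
    gcongr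
    linarith [le_abs_self C]
  | succ m ih =>
    intro g hg
    obtain ⟨g₁, g₂, hg₁, hg₂, H⟩ := radialOp_pow_mul n hh hg (q + 2 * m)
    obtain ⟨C₁, hC₁, h₁⟩ := ih hg₁
    obtain ⟨C₂, hC₂, h₂⟩ := ih hg₂
    refine ⟨C₁ + C₂, by positivity, fun a ha t ht => ?_⟩
    have ht0 : t ∈ Ioi (0 : ℝ) := lt_of_lt_of_le one_pos ht.1
    have e : (radialOp n a)^[m + 1] (fun t => h t ^ (q + 2 * (m + 1)) * g t) t =
        1 * (radialOp n a)^[m] (fun t => h t ^ (q + 2 * m) * g₁ t) t +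
          a * (radialOp n a)^[m] (fun t => h t ^ (q + 2 * m) * g₂ t) t := by
      rw [Function.iterate_succ_apply]
      exact ((H a).radialOp_iterate isOpen_Ioi n a m ht0).trans
        (radialOp_iterate_lincomb (by fun_prop) (by fun_prop) n a 1 a m ht0)
    rw [e]
    calc _ ≤ |1 * (radialOp n a)^[m] (fun t => h t ^ (q + 2 * m) * g₁ t) t| +
          |a * (radialOp n a)^[m] (fun t => h t ^ (q + 2 * m) * g₂ t) t| := abs_add_le _ _
      _ ≤ C₁ * |h t| ^ q + 1 * (C₂ * |h t| ^ q) := by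
        rw [one_mul, abs_mul, abs_of_nonneg ha.1]
        exact add_le_add (h₁ a ha t ht)
          (mul_le_mul ha.2 (h₂ a ha t ht) (abs_nonneg _) zero_le_one)
      _ = _ := by ring

/-! ### Powers and the bubble identity. -/

theorem contDiffOn_rpow_Ioi (s : ℝ) : ContDiffOn ℝ ∞ (fun t : ℝ => t ^ s) (Ioi 0) :=
  fun _ ht => (Real.contDiffAt_rpow_const_of_ne (ne_of_gt ht)).contDiffWithinAt

theorem radialOp_rpow (n : ℕ) (a s : ℝ) :
    EqOn (radialOp n a fun t => t ^ (-s))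
      (fun t => 2 * s * (n - 2 * s - 2) * t ^ (-(s + 1)) + 4 * s * (s + 1) * a * t ^ (-(s + 2)))
      (Ioi 0) := by
  have key : ∀ b c : ℝ, EqOn (deriv fun t : ℝ => c * t ^ b) (fun t => c * b * t ^ (b - 1))
      (Ioi 0) := by
    intro b c t ht
    refine ((Real.hasDerivAt_rpow_const (Or.inl (ne_of_gt ht))).const_mul c).deriv.trans ?_
    ring
  have h1 : EqOn (deriv fun t : ℝ => t ^ (-s)) (fun t => -s * t ^ (-s - 1)) (Ioi 0) := by
    intro t ht
    simpa using key (-s) 1 ht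
  intro t ht
  have h2 := (h1.deriv isOpen_Ioi ht).trans (key _ _ ht)
  have e1 : t ^ (-(s + 1)) = t * t ^ (-(s + 2)) := by
    rw [show -(s + 1) = -(s + 2) + 1 by ring, Real.rpow_add_one (ne_of_gt ht)]
    ring
  simp only [radialOp, h2, h1 ht]
  rw [show -s - 1 - 1 = -(s + 2) by ring, show -s - 1 = -(s + 1) by ring, e1]
  ring

/-- The constant in `(-Δ)^m (a + |x|²)^(m - n/2) = bubbleConst n m * a^m * (a + |x|²)^(-m - n/2)`. -/
noncomputable def bubbleConst (n : ℕ) : ℕ → ℝ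
  | 0 => 1
  | m + 1 => 4 * ((n : ℝ) / 2 - m - 1) * ((n : ℝ) / 2 + m) * bubbleConst n m

/-- One application to `t^(-s)` with `s = n/2 - m - 2` produces the powers `-(s + 1)` and `-(s +
2)`, which are the bubbles of orders `m + 1` and `m`. The remaining `m + 1` iterations are given by
the two induction hypotheses, the second followed by one more application. The two `t^(-(n/2 + m +
1))` terms cancel, which leaves a single power. -/
theorem radialOp_iterate_bubble (n : ℕ) (a : ℝ) (m : ℕ) :
    EqOn ((radialOp n a)^[m] fun t => t ^ (-((n : ℝ) / 2 - m)))
      (fun t => bubbleConst n m * a ^ m * t ^ (-((n : ℝ) / 2 + m))) (Ioi 0) := by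
  induction m using Nat.strong_induction_on with
  | _ m ih =>
  match m with
  | 0 => intro _ _; simp [bubbleConst]
  | 1 =>
    intro t ht
    have := radialOp_rpow n a ((n : ℝ) / 2 - 1) ht
    simp only [Function.iterate_one, bubbleConst]
    push_cast
    rw [this]
    simp only
    rw [show (n : ℝ) - 2 * (n / 2 - 1) - 2 = 0 by ring,
      show -((n : ℝ) / 2 - 1 + 2) = -(n / 2 + 1) by ring]
    ring
  | m + 2 =>
    set s : ℝ := (n : ℝ) / 2 - (m + 2 : ℕ) with hs
    have s1 := contDiffOn_rpow_Ioi (-(s + 1))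
    have s2 := contDiffOn_rpow_Ioi (-(s + 2))
    have i1 := ih (m + 1) (by omega)
    have i0 := ih m (by omega)
    rw [show (n : ℝ) / 2 - (m + 1 : ℕ) = s + 1 by rw [hs]; push_cast; ring] at i1
    rw [show (n : ℝ) / 2 - m = s + 2 by rw [hs]; push_cast; ring] at i0
    set w : ℝ := (n : ℝ) / 2 + m with hw
    have i2 : EqOn ((radialOp n a)^[m + 1] fun t => t ^ (-(s + 2)))
        (fun t => bubbleConst n m * a ^ m * (2 * w * (n - 2 * w - 2) * t ^ (-(w + 1)) +
          4 * w * (w + 1) * a * t ^ (-(w + 2)))) (Ioi 0) := by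
      rw [Function.iterate_succ_apply']
      refine (i0.radialOp isOpen_Ioi n a).trans fun t ht => ?_
      have := radialOp_lincomb (contDiffOn_rpow_Ioi (-w)) (contDiffOn_rpow_Ioi (-w)) n a
        (bubbleConst n m * a ^ m) 0 ht
      simp only [zero_mul, add_zero] at this
      rw [this, radialOp_rpow n a w ht]
    intro t ht
    rw [Function.iterate_succ_apply]
    have h0 := (radialOp_rpow n a s).radialOp_iterate isOpen_Ioi n a (m + 1) ht
    rw [h0, radialOp_iterate_lincomb s1 s2 n a _ _ (m + 1) ht]
    simp only
    rw [i1 ht, i2 ht]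
    simp only [bubbleConst]
    rw [show (n : ℝ) / 2 + (m + 1 : ℕ) = w + 1 by rw [hw]; push_cast; ring,
      show (n : ℝ) / 2 + (m + 2 : ℕ) = w + 2 by rw [hw]; push_cast; ring]
    have hn : (n : ℝ) = 2 * (w - m) := by rw [hw]; ring
    have hs' : s = w - 2 * m - 2 := by rw [hs, hw]; push_cast; ring
    rw [hs', hn]
    push_cast
    ring

/-! ### Radial test functions in the weak equation. -/

theorem hasFDerivAt_const_add_norm_sub_sq {E : Type*} [NormedAddCommGroup E]
    [InnerProductSpace ℝ E] (a : ℝ) (c x : E) :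
    HasFDerivAt (fun y => a + ‖y - c‖ ^ 2) ((2 : ℝ) • innerSL ℝ (x - c)) x := by
  have h := ((hasStrictFDerivAt_norm_sq (x - c)).hasFDerivAt.comp x
    ((hasFDerivAt_id x).sub_const c)).const_add a
  refine h.congr_fderiv ?_
  ext v
  simp

/-- The second derivative in a unit direction `v` is `2F' + 4F''⟨x - c, v⟩²`, and Parseval sums the
squares to `|x - c|² = t - a`. Positivity of `a` keeps the argument of `F` in `(0, ∞)`, even at the
centre. -/
theorem laplacian_comp_const_add_norm_sub_sq {n : ℕ} {a : ℝ} (ha : 0 < a)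
    (c : EuclideanSpace ℝ (Fin n)) {F : ℝ → ℝ} (hF : ContDiffOn ℝ ∞ F (Ioi 0))
    (x : EuclideanSpace ℝ (Fin n)) :
    -(Laplacian.laplacian (fun y : EuclideanSpace ℝ (Fin n) => F (a + ‖y - c‖ ^ 2)) x : ℝ) =
      radialOp n a F (a + ‖x - c‖ ^ 2) := by
  have hpos : ∀ y : EuclideanSpace ℝ (Fin n), 0 < a + ‖y - c‖ ^ 2 := fun y => by positivity
  have h1 : ∀ {G : ℝ → ℝ}, ContDiffOn ℝ ∞ G (Ioi 0) → ∀ y : EuclideanSpace ℝ (Fin n),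
      HasFDerivAt (fun y => G (a + ‖y - c‖ ^ 2))
        (deriv G (a + ‖y - c‖ ^ 2) • (2 : ℝ) • innerSL ℝ (y - c)) y := fun hG y =>
    (differentiableAt_of_contDiffOn_Ioi hG (hpos y)).hasDerivAt.comp_hasFDerivAt y
      (hasFDerivAt_const_add_norm_sub_sq a c y)
  have e1 : fderiv ℝ (fun y : EuclideanSpace ℝ (Fin n) => F (a + ‖y - c‖ ^ 2)) =
      fun y => deriv F (a + ‖y - c‖ ^ 2) • (2 : ℝ) • innerSL ℝ (y - c) :=
    funext fun y => (h1 hF y).fderiv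
  have h3 : HasFDerivAt (fun y : EuclideanSpace ℝ (Fin n) => (2 : ℝ) • innerSL ℝ (y - c))
      ((2 : ℝ) • (innerSL ℝ : EuclideanSpace ℝ (Fin n) →L[ℝ] _)) x :=
    ((innerSL ℝ : EuclideanSpace ℝ (Fin n) →L[ℝ] _).hasFDerivAt.comp x
      ((hasFDerivAt_id x).sub_const c)).const_smul (2 : ℝ)
  have h2 := (h1 hF.deriv_Ioi x).smul h3
  rw [InnerProductSpace.laplacian_eq_iteratedFDeriv_stdOrthonormalBasis]
  simp only [iteratedFDeriv_two_apply, e1]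
  have e2 : fderiv ℝ (fun y => deriv F (a + ‖y - c‖ ^ 2) • (2 : ℝ) • innerSL ℝ (y - c)) x = _ :=
    h2.fderiv
  have hsum := (stdOrthonormalBasis ℝ (EuclideanSpace ℝ (Fin n))).sum_sq_inner_left (x - c)
  have e3 : ∀ v : EuclideanSpace ℝ (Fin n), ‖v‖ = 1 →
      fderiv ℝ (fun y => deriv F (a + ‖y - c‖ ^ 2) • (2 : ℝ) • innerSL ℝ (y - c)) x v v =
      2 * deriv F (a + ‖x - c‖ ^ 2) +
        4 * deriv (deriv F) (a + ‖x - c‖ ^ 2) * inner ℝ (x - c) v ^ 2 := by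
    intro v hv
    rw [e2]
    change deriv F (a + ‖x - c‖ ^ 2) * (2 * inner ℝ v v) +
      deriv (deriv F) (a + ‖x - c‖ ^ 2) * (2 * inner ℝ (x - c) v) * (2 * inner ℝ (x - c) v) = _
    rw [real_inner_self_eq_norm_sq, hv]
    ring
  simp only [radialOp, Matrix.cons_val_zero, Matrix.cons_val_one,
    e3 _ (OrthonormalBasis.norm_eq_one _ _), Finset.sum_add_distrib, ← Finset.mul_sum, hsum]
  simp
  ring

theorem polyLaplacian_comp_const_add_norm_sub_sq {n : ℕ} {a : ℝ} (ha : 0 < a)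
    (c : EuclideanSpace ℝ (Fin n)) {F : ℝ → ℝ} (hF : ContDiffOn ℝ ∞ F (Ioi 0)) (m : ℕ) :
    polyLaplacian n m (fun y => F (a + ‖y - c‖ ^ 2)) =
      fun y => (radialOp n a)^[m] F (a + ‖y - c‖ ^ 2) := by
  induction m with
  | zero => rfl
  | succ m ih =>
    rw [polyLaplacian, Function.iterate_succ_apply', ← polyLaplacian, ih]
    funext x
    rw [Function.iterate_succ_apply']
    exact laplacian_comp_const_add_norm_sub_sq ha c (hF.radialOp_iterate n a m) x

theorem contDiff_comp_const_add_norm_sub_sq {E : Type*} [NormedAddCommGroup E]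
    [InnerProductSpace ℝ E] {a : ℝ} (ha : 0 < a) (c : E) {F : ℝ → ℝ}
    (hF : ContDiffOn ℝ ∞ F (Ioi 0)) : ContDiff ℝ ∞ fun y : E => F (a + ‖y - c‖ ^ 2) := by
  have h1 : ContDiff ℝ ∞ fun y : E => a + ‖y - c‖ ^ 2 :=
    contDiff_const.add ((contDiff_id.sub contDiff_const).norm_sq ℝ)
  rw [← contDiffOn_univ] at h1 ⊢
  exact hF.comp h1 fun y _ => by simp only [mem_Ioi]; positivity

theorem hasCompactSupport_comp_const_add_norm_sub_sq {E : Type*} [NormedAddCommGroup E]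
    [ProperSpace E] {a T : ℝ} (ha : 0 < a) (c : E) {F : ℝ → ℝ} (hF : ∀ t, T < t → F t = 0) :
    HasCompactSupport fun y : E => F (a + ‖y - c‖ ^ 2) := by
  refine HasCompactSupport.of_support_subset_isCompact
    (isCompact_closedBall c (Real.sqrt T)) fun y hy => ?_
  rw [mem_closedBall_iff_norm]
  apply Real.le_sqrt_of_sq_le
  by_contra hlt
  exact hy (hF _ (by linarith))

theorem MeasureTheory.LocallyIntegrable.integrable_mul_radial {n : ℕ}
    {U : EuclideanSpace ℝ (Fin n) → ℝ} (hU : LocallyIntegrable U) {a T : ℝ} (ha : 0 < a)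
    (c : EuclideanSpace ℝ (Fin n)) {F : ℝ → ℝ} (hF : ContDiffOn ℝ ∞ F (Ioi 0))
    (hT : ∀ t, T < t → F t = 0) : Integrable fun x => U x * F (a + ‖x - c‖ ^ 2) := by
  have h := hU.integrable_smul_left_of_hasCompactSupport
    (contDiff_comp_const_add_norm_sub_sq ha c hF).continuous
    (hasCompactSupport_comp_const_add_norm_sub_sq ha c hT)
  exact h.congr (Eventually.of_forall fun x => mul_comm _ _)

theorem radialOp_iterate_eq_zero {F : ℝ → ℝ} {T : ℝ} (hT : ∀ t, T < t → F t = 0) (n : ℕ) (a : ℝ)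
    (m : ℕ) : ∀ t, T < t → (radialOp n a)^[m] F t = 0 := by
  intro t ht
  have h : EqOn F (fun _ => 0) (Ioi T) := fun t ht => hT t ht
  rw [h.radialOp_iterate isOpen_Ioi n a m ht, radialOp_iterate_zero]

theorem IsDistributionalSolution.weak_eq_radial {n m : ℕ} {σ p : ℝ}
    {u : EuclideanSpace ℝ (Fin n) → ℝ} (hu : IsDistributionalSolution n m σ p u) {a T : ℝ}
    (ha : 0 < a) (c : EuclideanSpace ℝ (Fin n)) {F : ℝ → ℝ} (hF : ContDiffOn ℝ ∞ F (Ioi 0))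
    (hT : ∀ t, T < t → F t = 0) :
    ∫ x, u x * (radialOp n a)^[m] F (a + ‖x - c‖ ^ 2) =
      ∫ x, henonSource n σ p u x * F (a + ‖x - c‖ ^ 2) := by
  rw [← hu.weak_eq _ (contDiff_comp_const_add_norm_sub_sq ha c hF)
    (hasCompactSupport_comp_const_add_norm_sub_sq ha c hT),
    polyLaplacian_comp_const_add_norm_sub_sq ha c hF m]

/-! ### Cutoff and Young-type inequality. -/

/-- A smooth nonincreasing cutoff on the line, equal to `1` on `(-∞, 1]` and to `0` on
`[2, ∞)`. -/
noncomputable def lineCutoff (t : ℝ) : ℝ := Real.smoothTransition (2 - t)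

theorem lineCutoff_contDiff : ContDiff ℝ ∞ lineCutoff :=
  Real.smoothTransition.contDiff.comp (contDiff_const.sub contDiff_id)

theorem lineCutoff_nonneg (t : ℝ) : 0 ≤ lineCutoff t := Real.smoothTransition.nonneg _

theorem lineCutoff_le_one (t : ℝ) : lineCutoff t ≤ 1 := Real.smoothTransition.le_one _

theorem lineCutoff_of_le_one {t : ℝ} (ht : t ≤ 1) : lineCutoff t = 1 :=
  Real.smoothTransition.one_of_one_le (by linarith)

theorem lineCutoff_of_two_le {t : ℝ} (ht : 2 ≤ t) : lineCutoff t = 0 :=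
  Real.smoothTransition.zero_of_nonpos (by linarith)

theorem lineCutoff_antitone : Antitone lineCutoff := fun s t h =>
  Real.smoothTransition.monotone (by linarith)

/-- Either `u` is below the threshold `l^(-1/(p-1))`, or it is above it and then `l * u^(p-1) ≥ 1`.
-/
theorem le_mul_rpow_add_rpow {u l p : ℝ} (hu : 0 ≤ u) (hl : 0 < l) (hp : 1 < p) :
    u ≤ l * u ^ p + l ^ (-(1 / (p - 1))) := by
  have hp' : 0 < p - 1 := by linarith
  rcases hu.eq_or_lt with rfl | hu
  · rw [Real.zero_rpow (by linarith)]
    have := Real.rpow_pos_of_pos hl (-(1 / (p - 1)))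
    linarith
  rcases le_total (l ^ (-(1 / (p - 1)))) u with h | h
  · have h1 : (l ^ (-(1 / (p - 1)))) ^ (p - 1) ≤ u ^ (p - 1) :=
      Real.rpow_le_rpow (by positivity) h hp'.le
    rw [← Real.rpow_mul hl.le, show -(1 / (p - 1)) * (p - 1) = -1 by field_simp,
      Real.rpow_neg_one] at h1
    have h2 : 1 ≤ l * u ^ (p - 1) := by
      calc 1 = l * l⁻¹ := by field_simp
        _ ≤ _ := by gcongr
    have h3 : l * u ^ p = (l * u ^ (p - 1)) * u := by
      rw [mul_assoc, ← Real.rpow_add_one hu.ne', sub_add_cancel]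
    have := Real.rpow_pos_of_pos hl (-(1 / (p - 1)))
    nlinarith
  · have : 0 ≤ l * u ^ p := by positivity
    linarith

/-! ### Growth of the source and of the solution. -/

section
variable {n : ℕ}

theorem subset_closedBall_of_one_add_norm_sq_le (S : ℝ) :
    {x : EuclideanSpace ℝ (Fin n) | 1 + ‖x‖ ^ 2 ≤ S} ⊆ Metric.closedBall 0 (Real.sqrt S) := by
  intro x hx
  rw [mem_closedBall_zero_iff]
  exact Real.le_sqrt_of_sq_le (by linarith [hx.out])

theorem measurableSet_one_add_norm_sq_le (S : ℝ) :
    MeasurableSet {x : EuclideanSpace ℝ (Fin n) | 1 + ‖x‖ ^ 2 ≤ S} :=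
  measurableSet_le (by fun_prop) (by fun_prop)

theorem volume_one_add_norm_sq_le_lt_top (S : ℝ) :
    volume {x : EuclideanSpace ℝ (Fin n) | 1 + ‖x‖ ^ 2 ≤ S} < ⊤ :=
  (measure_mono (subset_closedBall_of_one_add_norm_sq_le S)).trans_lt
    measure_closedBall_lt_top

theorem volume_real_one_add_norm_sq_le {S : ℝ} (hS : 0 ≤ S) :
    volume.real {x : EuclideanSpace ℝ (Fin n) | 1 + ‖x‖ ^ 2 ≤ S} ≤
      S ^ ((n : ℝ) / 2) * volume.real (Metric.ball (0 : EuclideanSpace ℝ (Fin n)) 1) := by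
  refine (measureReal_mono (subset_closedBall_of_one_add_norm_sq_le S)
    measure_closedBall_lt_top.ne).trans_eq ?_
  rw [Measure.addHaar_real_closedBall _ _ (Real.sqrt_nonneg _), finrank_euclideanSpace_fin,
    Real.sqrt_eq_rpow, ← Real.rpow_mul_natCast hS]
  congr 2
  ring

theorem MeasureTheory.LocallyIntegrable.integrableOn_one_add_norm_sq_le
    {U : EuclideanSpace ℝ (Fin n) → ℝ} (hU : LocallyIntegrable U) (S : ℝ) :
    IntegrableOn U {x | 1 + ‖x‖ ^ 2 ≤ S} :=
  (hU.integrableOn_isCompact (isCompact_closedBall 0 (Real.sqrt S))).mono_set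
    (subset_closedBall_of_one_add_norm_sq_le S)

variable {m : ℕ} {σ p : ℝ} {u : EuclideanSpace ℝ (Fin n) → ℝ}

theorem IsDistributionalSolution.source_nonneg (hu : IsDistributionalSolution n m σ p u) :
    ∀ᵐ x, 0 ≤ henonSource n σ p u x := by
  filter_upwards [hu.nonneg] with x hx
  unfold henonSource
  positivity

theorem min_mul_rpow_le_rpow (s : ℝ) {S t : ℝ} (hS : 0 < S) (h1 : S / 2 ≤ t)
    (h2 : t ≤ 2 * S) : min ((1 / 2 : ℝ) ^ s) (2 ^ s) * S ^ s ≤ t ^ s := by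
  rcases le_total 0 s with hs | hs
  · calc _ ≤ (1 / 2 : ℝ) ^ s * S ^ s := by gcongr; exact min_le_left _ _
      _ = (S / 2) ^ s := by rw [← Real.mul_rpow (by norm_num) hS.le]; congr 1; ring
      _ ≤ _ := by gcongr
  · calc _ ≤ (2 : ℝ) ^ s * S ^ s := by gcongr; exact min_le_right _ _
      _ = (2 * S) ^ s := by rw [← Real.mul_rpow (by norm_num) hS.le]
      _ ≤ _ := Real.rpow_le_rpow_of_nonpos (by linarith) h2 hs

/-- Test function method: the Laplacian of the cutoff lives on the shell `S ≤ 1 + |x|² ≤ 2S`, where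
`|x|^σ` is comparable to `S^(σ/2)`. There `u` is split into half of the tested source, which is
absorbed, and a constant integrated over a ball. Note that `S` is a squared radius. -/
theorem IsDistributionalSolution.exists_setIntegral_source_le
    (hu : IsDistributionalSolution n m σ p u) (hm : 1 ≤ m) (hp : 1 < p) :
    ∃ C : ℝ, 0 ≤ C ∧ ∀ S : ℝ, 2 ≤ S →
      ∫ x in {x | 1 + ‖x‖ ^ 2 ≤ S}, henonSource n σ p u x ≤
        C * S ^ ((n : ℝ) / 2 - m - (σ / 2 + m) / (p - 1)) := by
  have hp' : 0 < p - 1 := by linarith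
  -- This gives `N * p ≥ N + 2 * m`, so `(h^N)^p` is dominated by the test function `h^(N + 2m)`.
  obtain ⟨N, hN⟩ : ∃ N : ℕ, 2 * (m : ℝ) / (p - 1) ≤ N := exists_nat_ge _
  rw [div_le_iff₀ hp'] at hN
  have hh : ContDiffOn ℝ ∞ lineCutoff (Ioi 0) := lineCutoff_contDiff.contDiffOn
  obtain ⟨C, hC, hbound⟩ := exists_radialOp_iterate_pow_mul_bound n m hh N
    (g := fun _ => 1) contDiffOn_const
  set K : ℝ → ℝ := fun t => lineCutoff t ^ (N + 2 * m) * 1 with hK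
  have hKs : ContDiff ℝ ∞ K := (lineCutoff_contDiff.pow _).mul contDiff_const
  set κ : ℝ := min ((1 / 2 : ℝ) ^ (σ / 2)) (2 ^ (σ / 2)) with hκ
  have hκ0 : 0 < κ := by positivity
  set V := volume.real (Metric.ball (0 : EuclideanSpace ℝ (Fin n)) 1) with hV
  refine ⟨2 * C * (κ / (2 * C)) ^ (-(1 / (p - 1))) * 2 ^ ((n : ℝ) / 2) * V, by positivity,
    fun S hS => ?_⟩
  have hS0 : 0 < S := by linarith
  set F : ℝ → ℝ := fun t => 1 * K (t / S) with hF
  have hFs : ContDiffOn ℝ ∞ F (Ioi 0) :=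
    (contDiff_const.mul (hKs.comp (contDiff_id.div_const S))).contDiffOn
  have hFT : ∀ t, 2 * S < t → F t = 0 := by
    intro t ht
    have : 2 ≤ t / S := by rw [le_div_iff₀ hS0]; exact ht.le
    simp only [hF, hK, lineCutoff_of_two_le this]
    rw [zero_pow (by omega)]; ring
  have hF0 : ∀ t, 0 ≤ F t := fun t => by
    have := lineCutoff_nonneg (t / S)
    simp only [hF, hK]; positivity
  have hF1 : ∀ t, t ≤ S → F t = 1 := by
    intro t ht
    simp only [hF, hK, lineCutoff_of_le_one ((div_le_one hS0).2 ht)]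
    simp
  -- Chosen so that `C / S^m * lam` is half of the lower bound `κ * S^(σ/2)` for `|x|^σ` on the
  -- shell.
  set lam : ℝ := κ * S ^ (σ / 2) / (2 * (C / S ^ m)) with hlam
  have hlam0 : 0 < lam := by positivity
  set b : ℝ := C / S ^ m * lam ^ (-(1 / (p - 1))) with hb
  have hb0 : 0 ≤ b := by positivity
  set A : Set (EuclideanSpace ℝ (Fin n)) := {x | 1 + ‖x‖ ^ 2 ≤ 2 * S} with hA
  have hAm : MeasurableSet A := measurableSet_one_add_norm_sq_le _
  have hpt : ∀ᵐ x, u x * (radialOp n 1)^[m] F (1 + ‖x - 0‖ ^ 2) ≤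
      1 / 2 * (henonSource n σ p u x * F (1 + ‖x - 0‖ ^ 2)) + A.indicator (fun _ => b) x := by
    filter_upwards [hu.nonneg, hu.source_nonneg] with x hx hfx
    rw [sub_zero]
    have hind : 0 ≤ A.indicator (fun _ => b) x := indicator_nonneg (fun _ _ => hb0) x
    have hfF := mul_nonneg hfx (hF0 (1 + ‖x‖ ^ 2))
    have hop : (radialOp n 1)^[m] F (1 + ‖x‖ ^ 2) =
        1 / S ^ m * (radialOp n (1 / S))^[m] K ((1 + ‖x‖ ^ 2) / S) :=
      congrFun (radialOp_iterate_comp_div n 1 1 hS0.ne' K m) _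
    rcases lt_or_ge (1 + ‖x‖ ^ 2) S with h1 | h1
    -- Inside, the profile is locally constant, and `m ≥ 1` annihilates it.
    · have hloc : EqOn K (fun _ => 1) (Iio 1) := fun t ht => by
        simp [hK, lineCutoff_of_le_one (le_of_lt (mem_Iio.1 ht))]
      rw [hop, hloc.radialOp_iterate isOpen_Iio n _ m ((div_lt_one hS0).2 h1),
        radialOp_iterate_const _ _ _ hm]
      linarith
    rcases lt_or_ge (2 * S) (1 + ‖x‖ ^ 2) with h2 | h2
    · rw [radialOp_iterate_eq_zero hFT n 1 m _ h2]
      linarith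
    set t := (1 + ‖x‖ ^ 2) / S with ht
    have htI : t ∈ Icc (1 : ℝ) 2 := ⟨(one_le_div hS0).2 h1, (div_le_iff₀ hS0).2 h2⟩
    have hbd := hbound (1 / S) ⟨by positivity, (div_le_one hS0).2 (by linarith)⟩ t htI
    set h := lineCutoff t with hht
    have hh0 : 0 ≤ h := lineCutoff_nonneg t
    have hh1 : h ≤ 1 := lineCutoff_le_one t
    rw [abs_of_nonneg hh0] at hbd
    rw [indicator_of_mem (show x ∈ A from h2), hop]
    have hxσ : κ * S ^ (σ / 2) ≤ ‖x‖ ^ σ := by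
      have := min_mul_rpow_le_rpow (σ / 2) hS0 (t := ‖x‖ ^ 2) (by linarith) (by linarith)
      refine this.trans_eq ?_
      rw [← Real.rpow_natCast_mul (norm_nonneg _)]
      congr 1
      push_cast
      ring
    have hv := le_mul_rpow_add_rpow (mul_nonneg hx (pow_nonneg hh0 N)) hlam0 hp
    have hvp : ‖x‖ ^ σ * (u x * h ^ N) ^ p ≤ henonSource n σ p u x * F (1 + ‖x‖ ^ 2) := by
      have e1 : (h ^ N) ^ p ≤ h ^ (N + 2 * m) := by
        rw [← Real.rpow_natCast, ← Real.rpow_natCast, ← Real.rpow_mul hh0]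
        rcases hh0.eq_or_lt with h00 | h00
        · rw [← h00, Real.zero_rpow, Real.zero_rpow]
          · exact_mod_cast (by omega)
          · have : (1 : ℝ) ≤ m := by exact_mod_cast hm
            have : 0 < (N : ℝ) := by nlinarith
            positivity
        · apply Real.rpow_le_rpow_of_exponent_ge h00 hh1
          push_cast
          linarith
      rw [Real.mul_rpow hx (pow_nonneg hh0 N), ← mul_assoc, henonSource]
      have e2 : F (1 + ‖x‖ ^ 2) = h ^ (N + 2 * m) := by simp [hF, hK, hht, ht]
      rw [e2]
      gcongr
    calc u x * (1 / S ^ m * (radialOp n (1 / S))^[m] K t)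
        ≤ u x * (1 / S ^ m * (C * h ^ N)) := by
          gcongr
          exact (le_abs_self _).trans hbd
      _ = C / S ^ m * (u x * h ^ N) := by ring
      _ ≤ C / S ^ m * (lam * (u x * h ^ N) ^ p + lam ^ (-(1 / (p - 1)))) := by gcongr
      _ = 1 / 2 * (κ * S ^ (σ / 2) * (u x * h ^ N) ^ p) + b := by
          rw [hb, hlam]; field_simp
      _ ≤ 1 / 2 * (‖x‖ ^ σ * (u x * h ^ N) ^ p) + b := by
          have : 0 ≤ (u x * h ^ N) ^ p := by positivity
          gcongr
      _ ≤ _ := by gcongr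
  have hfI : Integrable fun x => henonSource n σ p u x * F (1 + ‖x - 0‖ ^ 2) :=
    hu.locallyIntegrable_source.integrable_mul_radial one_pos 0 hFs hFT
  have huI : Integrable fun x => u x * (radialOp n 1)^[m] F (1 + ‖x - 0‖ ^ 2) :=
    hu.locallyIntegrable.integrable_mul_radial one_pos 0 (hFs.radialOp_iterate n 1 m)
      (radialOp_iterate_eq_zero hFT n 1 m)
  have hbI : Integrable (A.indicator fun _ => b) :=
    (integrableOn_const (volume_one_add_norm_sq_le_lt_top _).ne).integrable_indicator hAm
  have hint := integral_mono_ae huI ((hfI.const_mul (1 / 2)).add hbI) hpt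
  -- Now the same tested source integral stands on both sides, with coefficient `1/2` on the right.
  rw [hu.weak_eq_radial one_pos 0 hFs hFT] at hint
  simp only [Pi.add_apply] at hint
  rw [integral_add (hfI.const_mul (1 / 2)) hbI, integral_const_mul, integral_indicator hAm,
    setIntegral_const, smul_eq_mul] at hint
  have hvol := volume_real_one_add_norm_sq_le (n := n) (S := 2 * S) (by linarith)
  have hle : ∫ x in {x | 1 + ‖x‖ ^ 2 ≤ S}, henonSource n σ p u x ≤
      ∫ x, henonSource n σ p u x * F (1 + ‖x - 0‖ ^ 2) := by
    rw [← integral_indicator (measurableSet_one_add_norm_sq_le S)]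
    refine integral_mono_ae ((hu.locallyIntegrable_source.integrableOn_one_add_norm_sq_le
      S).integrable_indicator (measurableSet_one_add_norm_sq_le S)) hfI ?_
    filter_upwards [hu.source_nonneg] with x hfx
    by_cases hx : x ∈ {x : EuclideanSpace ℝ (Fin n) | 1 + ‖x‖ ^ 2 ≤ S}
    · rw [indicator_of_mem hx, sub_zero, hF1 _ hx.out, mul_one]
    · rw [indicator_of_notMem hx]
      exact mul_nonneg hfx (hF0 _)
  have hVA : volume.real A * b ≤ (2 * S) ^ ((n : ℝ) / 2) * V * b := by gcongr
  have hfin : (2 * S) ^ ((n : ℝ) / 2) * V * b * 2 =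
      2 * C * (κ / (2 * C)) ^ (-(1 / (p - 1))) * 2 ^ ((n : ℝ) / 2) * V *
        S ^ ((n : ℝ) / 2 - m - (σ / 2 + m) / (p - 1)) := by
    have e1 : lam = κ / (2 * C) * S ^ (σ / 2 + m) := by
      rw [Real.rpow_add_natCast hS0.ne', hlam]; field_simp
    have e2 : lam ^ (-(1 / (p - 1))) =
        (κ / (2 * C)) ^ (-(1 / (p - 1))) * S ^ (-((σ / 2 + m) / (p - 1))) := by
      rw [e1, Real.mul_rpow (by positivity) (by positivity), ← Real.rpow_mul hS0.le]
      congr 2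
      ring
    rw [hb, e2, Real.mul_rpow (by norm_num) hS0.le,
      show (n : ℝ) / 2 - m - (σ / 2 + m) / (p - 1) =
        (n : ℝ) / 2 + -((σ / 2 + m) / (p - 1)) - (m : ℕ) by ring,
      Real.rpow_sub_natCast hS0.ne', Real.rpow_add hS0]
    ring
  linarith
end

section
variable {n m : ℕ} {σ p : ℝ} {u : EuclideanSpace ℝ (Fin n) → ℝ}

theorem rpow_min_le_rpow (s : ℝ) {S t : ℝ} (h1 : 1 ≤ t) (h2 : t ≤ S) :
    S ^ min s 0 ≤ t ^ s := by
  have hS : 1 ≤ S := h1.trans h2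
  rcases le_total 0 s with hs | hs
  · rw [min_eq_right hs, Real.rpow_zero]
    exact Real.one_le_rpow h1 hs
  · rw [min_eq_left hs]
    exact Real.rpow_le_rpow_of_nonpos (by linarith) h2 hs

/-- The Young-type inequality bounds `u` by the source away from the origin. The unit ball is put
into the constant `G`, since `|x|^σ` has no positive lower bound near `0` when `σ > 0`. -/
theorem IsDistributionalSolution.exists_setIntegral_le
    (hu : IsDistributionalSolution n m σ p u) (hm : 1 ≤ m) (hp : 1 < p)
    (hσ : -(2 * (m : ℝ)) < σ) :
    ∃ C δ G : ℝ, 0 < δ ∧ ∀ S : ℝ, 2 ≤ S →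
      ∫ x in {x | 1 + ‖x‖ ^ 2 ≤ S}, u x ≤ G + C * S ^ ((n : ℝ) / 2 - δ) := by
  have hp' : 0 < p - 1 := by linarith
  have hm' : (1 : ℝ) ≤ m := by exact_mod_cast hm
  obtain ⟨C, hC, hsrc⟩ := hu.exists_setIntegral_source_le hm hp
  -- `S^μ` bounds `|x|^σ` from below on all of `1 ≤ |x|² ≤ S`, whatever the sign of `σ`; `σ > -2m`
  -- gives `m + μ > 0`.
  set μ : ℝ := min (σ / 2) 0 with hμ
  have hμ0 : 0 < m + μ := by
    rcases min_choice (σ / 2) 0 with h | h <;> rw [hμ, h] <;> linarith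
  set V := volume.real (Metric.ball (0 : EuclideanSpace ℝ (Fin n)) 1) with hV
  set B : Set (EuclideanSpace ℝ (Fin n)) := Metric.closedBall 0 1 with hB
  have huB : IntegrableOn u B := hu.locallyIntegrable.integrableOn_isCompact
    (isCompact_closedBall _ _)
  have huBi : Integrable (B.indicator u) := huB.integrable_indicator measurableSet_closedBall
  refine ⟨C + V, (m + μ) / (p - 1), ∫ x, B.indicator u x, by positivity, fun S hS => ?_⟩
  have hS0 : 0 < S := by linarith
  set A : Set (EuclideanSpace ℝ (Fin n)) := {x | 1 + ‖x‖ ^ 2 ≤ S} with hA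
  have hAm : MeasurableSet A := measurableSet_one_add_norm_sq_le _
  set b : ℝ := S ^ (-((m + μ) / (p - 1))) with hb
  have hb0 : 0 ≤ b := by positivity
  have hfA : IntegrableOn (henonSource n σ p u) A :=
    hu.locallyIntegrable_source.integrableOn_one_add_norm_sq_le S
  have huA : IntegrableOn u A := hu.locallyIntegrable.integrableOn_one_add_norm_sq_le S
  have hbA : IntegrableOn (fun _ => b) A :=
    integrableOn_const (volume_one_add_norm_sq_le_lt_top S).ne
  have hpt : ∀ᵐ x ∂volume.restrict A, u x ≤
      B.indicator u x + (S ^ m * henonSource n σ p u x + b) := by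
    rw [ae_restrict_iff' hAm]
    filter_upwards [hu.nonneg, hu.source_nonneg] with x hx hfx hxA
    have hxA' : 1 + ‖x‖ ^ 2 ≤ S := hxA
    have h0 : 0 ≤ S ^ m * henonSource n σ p u x := by positivity
    by_cases hxB : x ∈ B
    · rw [indicator_of_mem hxB]
      linarith
    · rw [indicator_of_notMem hxB, zero_add]
      have hx1 : 1 ≤ ‖x‖ := by
        rw [hB, mem_closedBall_zero_iff] at hxB
        linarith
      have hxσ : S ^ μ ≤ ‖x‖ ^ σ := by
        have := rpow_min_le_rpow (σ / 2) (t := ‖x‖ ^ 2) (S := S) (by nlinarith) (by linarith)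
        refine this.trans_eq ?_
        rw [← Real.rpow_natCast_mul (norm_nonneg _)]
        congr 1
        push_cast
        ring
      -- With `l = S^(μ + m)` the first term is at most `S^m` times the source and the second is
      -- exactly `b`.
      refine (le_mul_rpow_add_rpow hx (Real.rpow_pos_of_pos hS0 (μ + m)) hp).trans ?_
      rw [← Real.rpow_mul hS0.le, hb, show (μ + m) * -(1 / (p - 1)) = -((m + μ) / (p - 1)) by ring,
        Real.rpow_add_natCast hS0.ne', henonSource]
      have : 0 ≤ u x ^ p := by positivity
      calc _ = S ^ m * (S ^ μ * u x ^ p) + S ^ (-((m + μ) / (p - 1))) := by ring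
        _ ≤ _ := by gcongr
  have hfi : Integrable (fun x => S ^ m * henonSource n σ p u x + b) (volume.restrict A) :=
    (hfA.const_mul _).add hbA
  have hint := integral_mono_ae huA (huBi.restrict.add hfi) hpt
  have hbm : Integrable (fun x => S ^ m * henonSource n σ p u x) (volume.restrict A) :=
    hfA.const_mul _
  simp only [Pi.add_apply] at hint
  rw [integral_add huBi.restrict hfi, integral_add hbm hbA, integral_const_mul,
    setIntegral_const, smul_eq_mul] at hint
  have h1 : ∫ x in A, B.indicator u x ≤ ∫ x, B.indicator u x := by
    refine setIntegral_le_integral huBi ?_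
    filter_upwards [hu.nonneg] with x hx
    exact indicator_apply_nonneg fun _ => hx
  have h2 : S ^ m * ∫ x in A, henonSource n σ p u x ≤
      C * S ^ ((n : ℝ) / 2 - (m + μ) / (p - 1)) := by
    calc _ ≤ S ^ m * (C * S ^ ((n : ℝ) / 2 - m - (σ / 2 + m) / (p - 1))) := by
          gcongr
          exact hsrc S hS
      _ = C * S ^ ((n : ℝ) / 2 - (σ / 2 + m) / (p - 1)) := by
          rw [show (n : ℝ) / 2 - m - (σ / 2 + m) / (p - 1) =
            (n : ℝ) / 2 - (σ / 2 + m) / (p - 1) - (m : ℕ) by ring,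
            Real.rpow_sub_natCast hS0.ne']
          field_simp
      _ ≤ _ := by
          have : μ ≤ σ / 2 := min_le_left _ _
          gcongr ?_ * S ^ ((n : ℝ) / 2 - ?_ / _)
          · linarith
          · linarith
  have h3 : volume.real A * b ≤ V * S ^ ((n : ℝ) / 2 - (m + μ) / (p - 1)) := by
    calc _ ≤ S ^ ((n : ℝ) / 2) * V * b := by
          gcongr
          exact volume_real_one_add_norm_sq_le hS0.le
      _ = _ := by rw [hb, sub_eq_add_neg ((n : ℝ) / 2), Real.rpow_add hS0]; ring
  linarith

theorem IsDistributionalSolution.tendsto_setIntegral_closedBall_div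
    (hu : IsDistributionalSolution n m σ p u) (hm : 1 ≤ m) (hn : n ≠ 0) (hp : 1 < p)
    (hσ : -(2 * (m : ℝ)) < σ) (c : EuclideanSpace ℝ (Fin n)) :
    Tendsto (fun R : ℝ => (∫ x in Metric.closedBall c R, u x) / R ^ n) atTop (𝓝 0) := by
  obtain ⟨C, δ, G, hδ, hG⟩ := hu.exists_setIntegral_le hm hp hσ
  have hn' : (0 : ℝ) < n := by exact_mod_cast Nat.pos_of_ne_zero hn
  have hlim : Tendsto (fun R : ℝ => (G * (4 * R ^ 2) ^ (-((n : ℝ) / 2)) +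
      C * (4 * R ^ 2) ^ (-δ)) * 2 ^ n) atTop (𝓝 0) := by
    have hS : Tendsto (fun R : ℝ => 4 * R ^ 2) atTop atTop :=
      (tendsto_pow_atTop two_ne_zero).const_mul_atTop (by norm_num)
    have h1 := (tendsto_rpow_neg_atTop (y := (n : ℝ) / 2) (by positivity)).comp hS
    have h2 := (tendsto_rpow_neg_atTop hδ).comp hS
    simpa using ((h1.const_mul G).add (h2.const_mul C)).mul_const (2 ^ n)
  refine tendsto_of_tendsto_of_tendsto_of_le_of_le' tendsto_const_nhds hlim ?_ ?_
  · filter_upwards [eventually_ge_atTop 0] with R hR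
    have : 0 ≤ ∫ x in Metric.closedBall c R, u x :=
      integral_nonneg_of_ae (ae_restrict_of_ae hu.nonneg)
    positivity
  · filter_upwards [eventually_ge_atTop (‖c‖ + 1)] with R hR
    have hc := norm_nonneg c
    have hR1 : 1 ≤ R := by linarith
    have hR0 : 0 < R := by linarith
    -- `S = 4R²` leaves room for the shift of centre, and `S^(n/2) = 2^n R^n`.
    have hsub : Metric.closedBall c R ⊆ {x | 1 + ‖x‖ ^ 2 ≤ 4 * R ^ 2} := by
      intro x hx
      rw [mem_closedBall_iff_norm] at hx
      have h1 : ‖x‖ ≤ 2 * R - 1 := by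
        have := norm_add_le (x - c) c
        rw [sub_add_cancel] at this
        linarith
      have h2 : ‖x‖ ^ 2 ≤ (2 * R - 1) ^ 2 := by gcongr
      simp only [mem_ofPred_eq]
      nlinarith
    have h1 : ∫ x in Metric.closedBall c R, u x ≤
        ∫ x in {x | 1 + ‖x‖ ^ 2 ≤ 4 * R ^ 2}, u x :=
      setIntegral_mono_set (hu.locallyIntegrable.integrableOn_one_add_norm_sq_le _)
        (ae_restrict_of_ae hu.nonneg) hsub.eventuallyLE
    have h2 := h1.trans (hG (4 * R ^ 2) (by nlinarith))
    have hp : (0 : ℝ) < 4 * R ^ 2 := by positivity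
    have e1 : (4 * R ^ 2) ^ ((n : ℝ) / 2) = 2 ^ n * R ^ n := by
      rw [show (4 : ℝ) * R ^ 2 = (2 * R) ^ (2 : ℕ) by ring,
        ← Real.rpow_natCast_mul (by positivity)]
      rw [show ((2 : ℕ) : ℝ) * ((n : ℝ) / 2) = (n : ℕ) by push_cast; ring, Real.rpow_natCast,
        mul_pow]
    rw [div_le_iff₀ (by positivity)]
    refine h2.trans_eq ?_
    rw [sub_eq_add_neg, Real.rpow_add hp]
    have e2 : (4 * R ^ 2) ^ (-((n : ℝ) / 2)) * (2 ^ n * R ^ n) = 1 := by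
      rw [← e1, ← Real.rpow_add hp, neg_add_cancel, Real.rpow_zero]
    rw [e1]
    linear_combination (-G) * e2
end

/-! ### Mass of the bubble and the constants. -/

theorem lintegral_rpow_mul_exp_neg_mul_Ioi {a r : ℝ} (ha : 0 < a) (hr : 0 < r) :
    ∫⁻ t in Ioi (0 : ℝ), ENNReal.ofReal (t ^ (a - 1) * Real.exp (-(r * t))) =
      ENNReal.ofReal ((1 / r) ^ a * Real.Gamma a) := by
  have h := Real.integral_rpow_mul_exp_neg_mul_Ioi ha hr
  have hG := Real.Gamma_pos_of_pos ha
  have hi : IntegrableOn (fun t : ℝ => t ^ (a - 1) * Real.exp (-(r * t))) (Ioi 0) :=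
    .of_integral_ne_zero (by rw [h]; positivity)
  rw [← h, ofReal_integral_eq_lintegral_ofReal hi]
  refine (ae_restrict_iff' measurableSet_Ioi).2 (Eventually.of_forall fun t ht => ?_)
  have : 0 < t := ht
  positivity

theorem lintegral_exp_neg_mul_sq_norm (n : ℕ) {t : ℝ} (ht : 0 < t) :
    ∫⁻ x : EuclideanSpace ℝ (Fin n), ENNReal.ofReal (Real.exp (-t * ‖x‖ ^ 2)) =
      ENNReal.ofReal ((Real.pi / t) ^ ((n : ℝ) / 2)) := by
  have h := GaussianFourier.integral_rexp_neg_mul_sq_norm (V := EuclideanSpace ℝ (Fin n)) ht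
  rw [finrank_euclideanSpace_fin] at h
  have hi : Integrable (fun x : EuclideanSpace ℝ (Fin n) => Real.exp (-t * ‖x‖ ^ 2)) :=
    .of_integral_ne_zero (by rw [h]; positivity)
  rw [← h, ofReal_integral_eq_lintegral_ofReal hi (Eventually.of_forall fun x => by positivity)]

/-- The power is written as a Gamma integral of Gaussians; Tonelli and the Gaussian integral leave
another Gamma integral, convergent since `b > n/2`. -/
theorem lintegral_one_add_norm_sq_rpow_neg (n : ℕ) {b : ℝ} (hb : (n : ℝ) / 2 < b) :
    ∫⁻ x : EuclideanSpace ℝ (Fin n), ENNReal.ofReal ((1 + ‖x‖ ^ 2) ^ (-b)) =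
      ENNReal.ofReal
        (Real.pi ^ ((n : ℝ) / 2) * Real.Gamma (b - (n : ℝ) / 2) / Real.Gamma b) := by
  have hb0 : 0 < b := lt_of_le_of_lt (by positivity) hb
  have hG := Real.Gamma_pos_of_pos hb0
  have h1 : ∀ x : EuclideanSpace ℝ (Fin n), ENNReal.ofReal ((1 + ‖x‖ ^ 2) ^ (-b)) =
      ENNReal.ofReal (Real.Gamma b)⁻¹ * ∫⁻ t in Ioi (0 : ℝ),
        ENNReal.ofReal (t ^ (b - 1) * Real.exp (-((1 + ‖x‖ ^ 2) * t))) := by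
    intro x
    rw [lintegral_rpow_mul_exp_neg_mul_Ioi hb0 (by positivity),
      ← ENNReal.ofReal_mul (by positivity), one_div, Real.inv_rpow (by positivity),
      ← Real.rpow_neg (by positivity)]
    congr 1
    field_simp
  have h2 : ∀ t ∈ Ioi (0 : ℝ), ∫⁻ x : EuclideanSpace ℝ (Fin n),
      ENNReal.ofReal (t ^ (b - 1) * Real.exp (-((1 + ‖x‖ ^ 2) * t))) =
        ENNReal.ofReal (Real.pi ^ ((n : ℝ) / 2)) *
          ENNReal.ofReal (t ^ (b - (n : ℝ) / 2 - 1) * Real.exp (-(1 * t))) := by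
    intro t ht
    have ht0 : 0 < t := ht
    have e : ∀ x : EuclideanSpace ℝ (Fin n),
        ENNReal.ofReal (t ^ (b - 1) * Real.exp (-((1 + ‖x‖ ^ 2) * t))) =
          ENNReal.ofReal (t ^ (b - 1) * Real.exp (-(1 * t))) *
            ENNReal.ofReal (Real.exp (-t * ‖x‖ ^ 2)) := by
      intro x
      rw [← ENNReal.ofReal_mul (by positivity), mul_assoc, ← Real.exp_add]
      congr 3
      ring
    simp_rw [e]
    rw [lintegral_const_mul _ (by fun_prop), lintegral_exp_neg_mul_sq_norm n ht0,
      ← ENNReal.ofReal_mul (by positivity), ← ENNReal.ofReal_mul (by positivity),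
      Real.div_rpow Real.pi_pos.le ht0.le,
      show b - (n : ℝ) / 2 - 1 = b - 1 - (n : ℝ) / 2 by ring, Real.rpow_sub ht0 (b - 1)]
    congr 1
    ring
  have hmeas : Measurable (Function.uncurry fun (x : EuclideanSpace ℝ (Fin n)) (t : ℝ) =>
      ENNReal.ofReal (t ^ (b - 1) * Real.exp (-((1 + ‖x‖ ^ 2) * t)))) := by
    unfold Function.uncurry
    fun_prop
  simp_rw [h1]
  rw [lintegral_const_mul' _ _ ENNReal.ofReal_ne_top, lintegral_lintegral_swap hmeas.aemeasurable,
    setLIntegral_congr_fun measurableSet_Ioi h2, lintegral_const_mul' _ _ ENNReal.ofReal_ne_top,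
    lintegral_rpow_mul_exp_neg_mul_Ioi (by linarith) one_pos, ← ENNReal.ofReal_mul (by positivity),
    ← ENNReal.ofReal_mul (by positivity)]
  congr 1
  simp
  ring

/-- Each factor of the recursion is one step of `Γ(z + 1) = zΓ(z)` at each of the two arguments; `2m
< n` keeps `n/2 - m` positive. -/
theorem bubbleConst_mul_Gamma {n m : ℕ} (hn : 2 * m < n) :
    bubbleConst n m * Real.Gamma ((n : ℝ) / 2 - m) = 4 ^ m * Real.Gamma ((n : ℝ) / 2 + m) := by
  induction m with
  | zero => simp [bubbleConst]
  | succ m ih =>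
    have hn' : 2 * ((m : ℝ) + 1) < n := by exact_mod_cast hn
    have h1 : Real.Gamma ((n : ℝ) / 2 - m) =
        ((n : ℝ) / 2 - m - 1) * Real.Gamma ((n : ℝ) / 2 - m - 1) := by
      rw [← Real.Gamma_add_one (by linarith)]
      congr 1
      ring
    have hn0 : (0 : ℝ) < n := lt_trans (by positivity) hn'
    have h2 : Real.Gamma ((n : ℝ) / 2 + m + 1) =
        ((n : ℝ) / 2 + m) * Real.Gamma ((n : ℝ) / 2 + m) :=
      Real.Gamma_add_one (by positivity)
    have h3 := ih (by omega)
    simp only [bubbleConst]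
    push_cast
    rw [show (n : ℝ) / 2 - (m + 1) = n / 2 - m - 1 by ring, ← add_assoc, h2, pow_succ]
    rw [h1] at h3
    linear_combination 4 * ((n : ℝ) / 2 + m) * h3

theorem bubbleConst_pos {n m : ℕ} (hn : 2 * m < n) : 0 < bubbleConst n m := by
  have hn' : 2 * (m : ℝ) < n := by exact_mod_cast hn
  have hn0 : (0 : ℝ) < n := lt_of_le_of_lt (by positivity) hn'
  have h := bubbleConst_mul_Gamma hn
  have h1 : 0 < Real.Gamma ((n : ℝ) / 2 - m) := Real.Gamma_pos_of_pos (by linarith)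
  have h2 : 0 < Real.Gamma ((n : ℝ) / 2 + m) := Real.Gamma_pos_of_pos (by positivity)
  exact pos_of_mul_pos_left (by rw [h]; positivity) h1.le

theorem rieszConst_mul_bubbleConst {n m : ℕ} (hm : 1 ≤ m) (hn : 2 * m < n) :
    rieszConst n (2 * m) * (bubbleConst n m * (Real.pi ^ ((n : ℝ) / 2) *
      Real.Gamma ((n : ℝ) / 2 + m - (n : ℝ) / 2) / Real.Gamma ((n : ℝ) / 2 + m))) = 1 := by
  have hn' : 2 * (m : ℝ) < n := by exact_mod_cast hn
  have hm' : (0 : ℝ) < m := by exact_mod_cast hm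
  have h := bubbleConst_mul_Gamma hn
  have h1 : 0 < Real.Gamma ((n : ℝ) / 2 - m) := Real.Gamma_pos_of_pos (by linarith)
  have h2 : 0 < Real.Gamma ((n : ℝ) / 2 + m) := Real.Gamma_pos_of_pos (by positivity)
  have h3 : 0 < Real.Gamma (m : ℝ) := Real.Gamma_pos_of_pos hm'
  have h4 : (2 : ℝ) ^ (2 * (m : ℝ)) = 4 ^ m := by
    rw [Real.rpow_mul (by norm_num), Real.rpow_natCast]
    norm_num
  rw [rieszConst, show ((n : ℝ) - 2 * m) / 2 = (n : ℝ) / 2 - m by ring, add_sub_cancel_left,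
    mul_div_cancel_left₀ _ two_ne_zero, h4]
  revert h h1 h2
  generalize Real.Gamma ((n : ℝ) / 2 - m) = x
  generalize Real.Gamma ((n : ℝ) / 2 + m) = y
  intro h h1 h2
  field_simp
  linear_combination h

/-! ### Approximate identity at a differentiation point. -/

section
variable {n : ℕ}

theorem setOf_le_bubble_of_lt_one {b ε t : ℝ} (hb : 0 < b) (hε : 0 < ε) (ht : 0 < t)
    (ht1 : t < 1) (c : EuclideanSpace ℝ (Fin n)) :
    {x | t ≤ (1 + ‖x - c‖ ^ 2 / ε ^ 2) ^ (-b)} =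
      Metric.closedBall c (ε * Real.sqrt (t ^ (-b)⁻¹ - 1)) := by
  have h1 : 1 < t ^ (-b)⁻¹ :=
    Real.one_lt_rpow_of_pos_of_lt_one_of_neg ht ht1 (inv_lt_zero.2 (by linarith))
  ext x
  rw [mem_ofPred_eq, mem_closedBall_iff_norm, ← Real.le_rpow_inv_iff_of_neg (by positivity) ht
    (by linarith), ← div_le_iff₀' hε, Real.le_sqrt (by positivity) (by linarith), div_pow]
  constructor <;> intro h <;> linarith

theorem setOf_le_bubble_of_one_lt {b t : ℝ} (hb : 0 < b) (ε : ℝ) (ht1 : 1 < t)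
    (c : EuclideanSpace ℝ (Fin n)) :
    {x | t ≤ (1 + ‖x - c‖ ^ 2 / ε ^ 2) ^ (-b)} = ∅ := by
  refine eq_empty_of_forall_notMem fun x hx => ?_
  have : (1 + ‖x - c‖ ^ 2 / ε ^ 2) ^ (-b) ≤ 1 :=
    Real.rpow_le_one_of_one_le_of_nonpos (by linarith [show 0 ≤ ‖x - c‖ ^ 2 / ε ^ 2 by positivity])
      (by linarith)
  linarith [hx.out]

theorem lintegral_bubble_eq_lintegral_measure {b : ℝ} (ν : Measure (EuclideanSpace ℝ (Fin n)))
    (ε : ℝ) (c : EuclideanSpace ℝ (Fin n)) :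
    ∫⁻ x, ENNReal.ofReal ((1 + ‖x - c‖ ^ 2 / ε ^ 2) ^ (-b)) ∂ν =
      ∫⁻ t in Ioi 0, ν {x | t ≤ (1 + ‖x - c‖ ^ 2 / ε ^ 2) ^ (-b)} := by
  apply lintegral_eq_lintegral_meas_le
  · exact Eventually.of_forall fun x => by positivity
  · exact Measurable.aemeasurable (by fun_prop)

/-- By the layer cake formula the integral only sees `ν` on balls about `c`. Each normalised level
converges by `hleb`, and `hgrow` dominates it by `M` times the corresponding Lebesgue volume,
integrable in `t` because `b > n/2`. The level `t = 1`, a ball of radius `0`, is discarded as null.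
-/
theorem tendsto_lintegral_bubble (hn : n ≠ 0) {b : ℝ} (hb : (n : ℝ) / 2 < b)
    {ν : Measure (EuclideanSpace ℝ (Fin n))} {c : EuclideanSpace ℝ (Fin n)} {M g : ENNReal}
    (hM : M ≠ ⊤)
    (hgrow : ∀ r, 0 < r → ν (Metric.closedBall c r) ≤ M * volume (Metric.closedBall c r))
    (hleb : Tendsto (fun r => ν (Metric.closedBall c r) / volume (Metric.closedBall c r)) (𝓝[>] 0)
      (𝓝 g))
    {ε : ℕ → ℝ} (hε : ∀ k, 0 < ε k) (hε0 : Tendsto ε atTop (𝓝 0)) :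
    Tendsto (fun k => (ENNReal.ofReal (ε k ^ n))⁻¹ *
      ∫⁻ x, ENNReal.ofReal ((1 + ‖x - c‖ ^ 2 / ε k ^ 2) ^ (-b)) ∂ν) atTop
      (𝓝 (g * ∫⁻ x : EuclideanSpace ℝ (Fin n), ENNReal.ofReal ((1 + ‖x‖ ^ 2) ^ (-b)))) := by
  have hb0 : 0 < b := lt_of_le_of_lt (by positivity) hb
  have hanti : ∀ (μ : Measure (EuclideanSpace ℝ (Fin n))) (e : ℝ) (z : EuclideanSpace ℝ (Fin n)),
      Measurable fun t : ℝ => μ {x | t ≤ (1 + ‖x - z‖ ^ 2 / e ^ 2) ^ (-b)} := fun μ e z =>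
    Antitone.measurable fun s t hst => measure_mono fun x hx => hst.trans hx
  have hvol1 : ∫⁻ x : EuclideanSpace ℝ (Fin n), ENNReal.ofReal ((1 + ‖x‖ ^ 2) ^ (-b)) =
      ∫⁻ t in Ioi 0, volume
        {x : EuclideanSpace ℝ (Fin n) | t ≤ (1 + ‖x - 0‖ ^ 2 / 1 ^ 2) ^ (-b)} := by
    rw [← lintegral_bubble_eq_lintegral_measure]
    simp
  have hfin : ∫⁻ x : EuclideanSpace ℝ (Fin n), ENNReal.ofReal ((1 + ‖x‖ ^ 2) ^ (-b)) ≠ ⊤ := by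
    rw [lintegral_one_add_norm_sq_rpow_neg n hb]
    exact ENNReal.ofReal_ne_top
  have hne1 : ∀ᵐ t : ℝ ∂volume.restrict (Ioi 0), t ≠ 1 :=
    ae_restrict_of_ae (measure_eq_zero_iff_ae_notMem.1 (measure_singleton (1 : ℝ)))
  have hball : ∀ k ρ, 0 < ρ → volume (Metric.closedBall c (ε k * ρ)) =
      ENNReal.ofReal (ε k ^ n) * volume (Metric.closedBall (0 : EuclideanSpace ℝ (Fin n)) ρ) := by
    intro k ρ hρ
    rw [Measure.addHaar_closedBall_mul _ _ (hε k).le hρ.le, finrank_euclideanSpace_fin]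
  have hεn0 : ∀ k, ENNReal.ofReal (ε k ^ n) ≠ 0 := fun k =>
    (ENNReal.ofReal_pos.2 (pow_pos (hε k) n)).ne'
  have hρpos : ∀ t : ℝ, 0 < t → t < 1 → 0 < Real.sqrt (t ^ (-b)⁻¹ - 1) := fun t ht ht1 =>
    Real.sqrt_pos.2 (sub_pos.2 (Real.one_lt_rpow_of_pos_of_lt_one_of_neg ht ht1
      (inv_lt_zero.2 (by linarith))))
  have hone : ∀ t : ℝ, 0 < t → t < 1 →
      {x : EuclideanSpace ℝ (Fin n) | t ≤ (1 + ‖x - 0‖ ^ 2 / 1 ^ 2) ^ (-b)} =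
        Metric.closedBall 0 (Real.sqrt (t ^ (-b)⁻¹ - 1)) := fun t ht ht1 => by
    rw [setOf_le_bubble_of_lt_one hb0 one_pos ht ht1, one_mul]
  rw [hvol1, ← lintegral_const_mul _ (hanti _ _ _)]
  have hL : ∀ k, (ENNReal.ofReal (ε k ^ n))⁻¹ *
      ∫⁻ x, ENNReal.ofReal ((1 + ‖x - c‖ ^ 2 / ε k ^ 2) ^ (-b)) ∂ν =
      ∫⁻ t in Ioi 0, (ENNReal.ofReal (ε k ^ n))⁻¹ *
        ν {x | t ≤ (1 + ‖x - c‖ ^ 2 / ε k ^ 2) ^ (-b)} := fun k => by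
    rw [lintegral_bubble_eq_lintegral_measure, lintegral_const_mul _ (hanti _ _ _)]
  simp_rw [hL]
  refine tendsto_lintegral_of_dominated_convergence (fun t => M * volume
    {x : EuclideanSpace ℝ (Fin n) | t ≤ (1 + ‖x - 0‖ ^ 2 / 1 ^ 2) ^ (-b)})
    (fun k => (hanti _ _ _).const_mul _) (fun k => ?_) ?_ ?_
  · filter_upwards [hne1, ae_restrict_mem measurableSet_Ioi] with t ht1 ht
    rcases lt_or_gt_of_ne ht1 with h | h
    · rw [setOf_le_bubble_of_lt_one hb0 (hε k) ht h, hone t ht h]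
      have hρ := hρpos t ht h
      calc _ ≤ (ENNReal.ofReal (ε k ^ n))⁻¹ * (M * (ENNReal.ofReal (ε k ^ n) *
            volume (Metric.closedBall (0 : EuclideanSpace ℝ (Fin n)) _))) := by
            gcongr
            rw [← hball k _ hρ]
            exact hgrow _ (mul_pos (hε k) hρ)
        _ = (ENNReal.ofReal (ε k ^ n))⁻¹ * ENNReal.ofReal (ε k ^ n) * (M *
            volume (Metric.closedBall (0 : EuclideanSpace ℝ (Fin n)) _)) := by ring
        _ = _ := by rw [ENNReal.inv_mul_cancel (hεn0 k) ENNReal.ofReal_ne_top, one_mul]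
    · rw [setOf_le_bubble_of_one_lt hb0 _ h]
      simp
  · rw [lintegral_const_mul _ (hanti _ _ _), ← hvol1]
    exact ENNReal.mul_ne_top hM hfin
  · filter_upwards [hne1, ae_restrict_mem measurableSet_Ioi] with t ht1 ht
    rcases lt_or_gt_of_ne ht1 with h | h
    · rw [hone t ht h]
      have hρ := hρpos t ht h
      simp_rw [fun k => setOf_le_bubble_of_lt_one hb0 (hε k) ht h c]
      set ρ := Real.sqrt (t ^ (-b)⁻¹ - 1)
      have hvρ : volume (Metric.closedBall (0 : EuclideanSpace ℝ (Fin n)) ρ) ≠ ⊤ :=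
        measure_closedBall_lt_top.ne
      have hvρ0 : volume (Metric.closedBall (0 : EuclideanSpace ℝ (Fin n)) ρ) ≠ 0 :=
        (Metric.measure_closedBall_pos _ _ hρ).ne'
      have hlim : Tendsto (fun k => ε k * ρ) atTop (𝓝[>] 0) := by
        refine tendsto_nhdsWithin_iff.2 ⟨by simpa using hε0.mul_const ρ, ?_⟩
        exact Eventually.of_forall fun k => mul_pos (hε k) hρ
      refine (ENNReal.Tendsto.mul_const (hleb.comp hlim) (Or.inr hvρ)).congr fun k => ?_
      simp only [Function.comp_apply]
      rw [hball k ρ hρ, ENNReal.div_eq_inv_mul, ENNReal.mul_inv (Or.inl (hεn0 k))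
        (Or.inl ENNReal.ofReal_ne_top)]
      calc _ = (volume (Metric.closedBall (0 : EuclideanSpace ℝ (Fin n)) ρ))⁻¹ *
            volume (Metric.closedBall (0 : EuclideanSpace ℝ (Fin n)) ρ) *
            ((ENNReal.ofReal (ε k ^ n))⁻¹ * ν (Metric.closedBall c (ε k * ρ))) := by ring
        _ = _ := by rw [ENNReal.inv_mul_cancel hvρ0 hvρ, one_mul]
    · simp_rw [fun k => setOf_le_bubble_of_one_lt hb0 (ε k) h c]
      rw [setOf_le_bubble_of_one_lt hb0 _ h]
      simp

/-- Finiteness of the maximal function at `c`: small radii are controlled by differentiation and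
large ones by growth. Other radii `r ≥ r₀` are enlarged to `q * r`, past the growth threshold. -/
theorem exists_measure_closedBall_le {ν : Measure (EuclideanSpace ℝ (Fin n))}
    {c : EuclideanSpace ℝ (Fin n)} {g : ENNReal} (hg : g ≠ ⊤)
    (hleb : Tendsto (fun r => ν (Metric.closedBall c r) / volume (Metric.closedBall c r)) (𝓝[>] 0)
      (𝓝 g))
    (hinf : ∀ᶠ r : ℝ in atTop, ν (Metric.closedBall c r) ≤ ENNReal.ofReal (r ^ n)) :
    ∃ M : ENNReal, M ≠ ⊤ ∧
      ∀ r, 0 < r → ν (Metric.closedBall c r) ≤ M * volume (Metric.closedBall c r) := by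
  have hpos : ∀ r : ℝ, 0 < r → volume (Metric.closedBall c r) ≠ 0 := fun r hr =>
    (Metric.measure_closedBall_pos _ _ hr).ne'
  have hlt : ∀ r : ℝ, volume (Metric.closedBall c r) ≠ ⊤ := fun r =>
    measure_closedBall_lt_top.ne
  have hev : ∀ᶠ r in 𝓝[>] (0 : ℝ),
      ν (Metric.closedBall c r) / volume (Metric.closedBall c r) < g + 1 :=
    hleb.eventually_lt_const (ENNReal.lt_add_right hg one_ne_zero)
  obtain ⟨r₀, hr₀, hsmall⟩ := mem_nhdsGT_iff_exists_Ioo_subset.1 hev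
  have hr₀' : (0 : ℝ) < r₀ := hr₀
  obtain ⟨R₁, hR₁⟩ := eventually_atTop.1 hinf
  set V := volume (Metric.closedBall (0 : EuclideanSpace ℝ (Fin n)) 1) with hV
  have hV0 : V ≠ 0 := (Metric.measure_closedBall_pos _ _ one_pos).ne'
  have hVt : V ≠ ⊤ := measure_closedBall_lt_top.ne
  set q : ℝ := max 1 (R₁ / r₀) with hq
  have hq1 : 1 ≤ q := le_max_left _ _
  refine ⟨g + 1 + ENNReal.ofReal (q ^ n) / V, ?_, fun r hr => ?_⟩
  · exact ENNReal.add_ne_top.2 ⟨by finiteness, ENNReal.div_ne_top ENNReal.ofReal_ne_top hV0⟩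
  rcases lt_or_ge r r₀ with h | h
  · have h1 : ν (Metric.closedBall c r) / volume (Metric.closedBall c r) ≤ g + 1 :=
      (hsmall ⟨hr, h⟩ : _ < _).le
    rw [ENNReal.div_le_iff (hpos r hr) (hlt r)] at h1
    exact h1.trans (by gcongr ?_ * _; exact le_self_add)
  · have h1 : R₁ ≤ q * r := by
      calc R₁ = R₁ / r₀ * r₀ := by field_simp
        _ ≤ q * r₀ := by gcongr; exact le_max_right _ _
        _ ≤ q * r := by gcongr
    have h2 : volume (Metric.closedBall c r) = ENNReal.ofReal (r ^ n) * V := by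
      rw [Measure.addHaar_closedBall' _ _ hr.le, finrank_euclideanSpace_fin]
    calc ν (Metric.closedBall c r) ≤ ν (Metric.closedBall c (q * r)) :=
          measure_mono (Metric.closedBall_subset_closedBall (by nlinarith))
      _ ≤ ENNReal.ofReal ((q * r) ^ n) := hR₁ _ h1
      _ = ENNReal.ofReal (q ^ n) / V * (ENNReal.ofReal (r ^ n) * V) := by
          rw [mul_pow, ENNReal.ofReal_mul (by positivity), mul_left_comm,
            ENNReal.div_mul_cancel hV0 hVt, mul_comm]
      _ ≤ (g + 1 + ENNReal.ofReal (q ^ n) / V) * volume (Metric.closedBall c r) := by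
          rw [h2]
          gcongr
          exact le_add_self
end

/-! ### Testing with truncated bubbles. -/

section
variable {n m : ℕ} {σ p : ℝ} {u : EuclideanSpace ℝ (Fin n) → ℝ}

/-- The profile `t ↦ t ^ (-s)`, cut off at scale `S`. -/
noncomputable def cutoffPower (s S : ℝ) (t : ℝ) : ℝ := t ^ (-s) * lineCutoff (t / S)

theorem cutoffPower_contDiffOn (s S : ℝ) : ContDiffOn ℝ ∞ (cutoffPower s S) (Ioi 0) :=
  (contDiffOn_rpow_Ioi (-s)).mul
    (lineCutoff_contDiff.comp (contDiff_id.div_const S)).contDiffOn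

theorem cutoffPower_eq_zero (s : ℝ) {S : ℝ} (hS : 0 < S) :
    ∀ t, 2 * S < t → cutoffPower s S t = 0 := by
  intro t ht
  rw [cutoffPower, lineCutoff_of_two_le ((le_div_iff₀ hS).2 ht.le), mul_zero]

theorem cutoffPower_of_le (s : ℝ) {S t : ℝ} (hS : 0 < S) (ht : t ≤ S) :
    cutoffPower s S t = t ^ (-s) := by
  rw [cutoffPower, lineCutoff_of_le_one ((div_le_one hS).2 ht), mul_one]

theorem cutoffPower_nonneg (s S : ℝ) {t : ℝ} (ht : 0 < t) : 0 ≤ cutoffPower s S t :=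
  mul_nonneg (by positivity) (lineCutoff_nonneg _)

theorem cutoffPower_mono (s : ℝ) {S S' t : ℝ} (hS : 0 < S) (hSS' : S ≤ S') (ht : 0 < t) :
    cutoffPower s S t ≤ cutoffPower s S' t := by
  unfold cutoffPower
  gcongr ?_ * ?_
  exact lineCutoff_antitone (by gcongr)

theorem radialOp_iterate_cutoffPower_of_lt (n m : ℕ) (a : ℝ) {S t : ℝ} (ht : 0 < t)
    (htS : t < S) :
    (radialOp n a)^[m] (cutoffPower ((n : ℝ) / 2 - m) S) t =
      bubbleConst n m * a ^ m * t ^ (-((n : ℝ) / 2 + m)) := by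
  have h : EqOn (cutoffPower ((n : ℝ) / 2 - m) S) (fun t => t ^ (-((n : ℝ) / 2 - m))) (Iio S) := by
    intro r hr
    exact cutoffPower_of_le _ (ht.trans htS) (le_of_lt hr)
  rw [h.radialOp_iterate isOpen_Iio n a m htS]
  exact radialOp_iterate_bubble n a m ht

/-- Rescaling reduces to `S = 1` with shift `a / S ≤ 1`; the general bound then applies with trivial
`h = 1` and `q = 0`. -/
theorem exists_radialOp_iterate_cutoffPower_bound (n m : ℕ) :
    ∃ C : ℝ, 0 < C ∧ ∀ a S t : ℝ, 0 < a → a ≤ S → S ≤ t → t ≤ 2 * S →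
      |(radialOp n a)^[m] (cutoffPower ((n : ℝ) / 2 - m) S) t| ≤ C * S ^ (-((n : ℝ) / 2)) := by
  set s : ℝ := (n : ℝ) / 2 - m with hs
  obtain ⟨C, hC, H⟩ := exists_radialOp_iterate_pow_mul_bound n m (h := fun _ => 1)
    contDiffOn_const 0 (cutoffPower_contDiffOn s 1)
  refine ⟨C, hC, fun a S t ha haS hSt htS => ?_⟩
  have hS : 0 < S := ha.trans_le haS
  have e : EqOn (cutoffPower s S) (fun t => S ^ (-s) * cutoffPower s 1 (t / S)) (Ioi 0) := by
    intro r hr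
    have hr0 : 0 < r := hr
    simp only [cutoffPower, div_one]
    rw [Real.div_rpow hr0.le hS.le]
    field_simp
  rw [e.radialOp_iterate isOpen_Ioi n a m (hS.trans_le hSt), radialOp_iterate_comp_div _ _ _ hS.ne']
  have := H (a / S) ⟨by positivity, (div_le_one hS).2 haS⟩ (t / S)
    ⟨(one_le_div hS).2 hSt, (div_le_iff₀ hS).2 htS⟩
  simp only [one_pow, one_mul, pow_zero, mul_one] at this
  rw [abs_mul, abs_of_pos (by positivity), mul_comm C,
    show -((n : ℝ) / 2) = -s - (m : ℕ) by rw [hs]; ring, Real.rpow_sub_natCast hS.ne']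
  gcongr

/-- Below `S` the truncated bubble has the exact image. Beyond, the error is at most the tail of `η`
plus, on the shell, `C * S^(-n/2) * u`, whose integral vanishes by the `o(R^n)` growth. -/
theorem IsDistributionalSolution.tendsto_integral_source_cutoffPower
    (hu : IsDistributionalSolution n m σ p u) (hm : 1 ≤ m) (hn : 2 * m < n) (hp : 1 < p)
    (hσ : -(2 * (m : ℝ)) < σ) {a : ℝ} (ha : 0 < a) (c : EuclideanSpace ℝ (Fin n))
    (hint : Integrable fun x => u x * (a + ‖x - c‖ ^ 2) ^ (-((n : ℝ) / 2 + m))) :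
    Tendsto (fun S : ℝ => ∫ x, henonSource n σ p u x *
        cutoffPower ((n : ℝ) / 2 - m) S (a + ‖x - c‖ ^ 2)) atTop
      (𝓝 (∫ x, bubbleConst n m * a ^ m *
        (u x * (a + ‖x - c‖ ^ 2) ^ (-((n : ℝ) / 2 + m))))) := by
  obtain ⟨C, hC, hbd⟩ := exists_radialOp_iterate_cutoffPower_bound n m
  have hc := bubbleConst_pos hn
  set η : EuclideanSpace ℝ (Fin n) → ℝ := fun x =>
    bubbleConst n m * a ^ m * (u x * (a + ‖x - c‖ ^ 2) ^ (-((n : ℝ) / 2 + m))) with hη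
  have hηI : Integrable η := hint.const_mul _
  set D : ℝ → Set (EuclideanSpace ℝ (Fin n)) := fun S => {x | S ≤ a + ‖x - c‖ ^ 2} with hD
  have hDm : ∀ S, MeasurableSet (D S) := fun S => measurableSet_le (by fun_prop) (by fun_prop)
  set B : ℝ → Set (EuclideanSpace ℝ (Fin n)) := fun S =>
    Metric.closedBall c (Real.sqrt (2 * S)) with hB
  have huB : ∀ S, Integrable ((B S).indicator u) := fun S =>
    (hu.locallyIntegrable.integrableOn_isCompact (isCompact_closedBall _ _)).integrable_indicator
      measurableSet_closedBall
  have hlim1 : Tendsto (fun S => ∫ x, (D S).indicator η x) atTop (𝓝 0) := by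
    have : Tendsto (fun S => ∫ x, (D S).indicator η x) atTop
        (𝓝 (∫ _ : EuclideanSpace ℝ (Fin n), (0 : ℝ))) := by
      refine tendsto_integral_filter_of_dominated_convergence (fun x => ‖η x‖)
        (Eventually.of_forall fun S => (hηI.indicator (hDm S)).aestronglyMeasurable)
        (Eventually.of_forall fun S => Eventually.of_forall fun x => norm_indicator_le_norm_self _ _)
        hηI.norm (Eventually.of_forall fun x => ?_)
      refine tendsto_const_nhds.congr' ?_
      filter_upwards [eventually_gt_atTop (a + ‖x - c‖ ^ 2)] with S hS
      have hx : x ∉ D S := not_le.2 hS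
      rw [indicator_of_notMem hx]
    simpa using this
  have hlim2 : Tendsto (fun S : ℝ => C * S ^ (-((n : ℝ) / 2)) * ∫ x, (B S).indicator u x) atTop
      (𝓝 0) := by
    have hR : Tendsto (fun S : ℝ => Real.sqrt (2 * S)) atTop atTop :=
      Real.tendsto_sqrt_atTop.comp (tendsto_id.const_mul_atTop (by norm_num))
    have h := ((hu.tendsto_setIntegral_closedBall_div hm (by omega) hp hσ c).comp hR).const_mul
      (C * 2 ^ ((n : ℝ) / 2))
    rw [mul_zero] at h
    refine h.congr' ?_
    filter_upwards [eventually_gt_atTop 0] with S hS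
    simp only [Function.comp_apply]
    have e : Real.sqrt (2 * S) ^ n = 2 ^ ((n : ℝ) / 2) * S ^ ((n : ℝ) / 2) := by
      rw [Real.sqrt_eq_rpow, ← Real.rpow_mul_natCast (by positivity),
        ← Real.mul_rpow (by norm_num) hS.le]
      congr 1
      ring
    rw [integral_indicator measurableSet_closedBall, e, Real.rpow_neg hS.le]
    field_simp
  rw [tendsto_iff_norm_sub_tendsto_zero]
  have hlim := hlim1.add hlim2
  rw [add_zero] at hlim
  refine squeeze_zero' (Eventually.of_forall fun _ => norm_nonneg _) ?_ hlim
  filter_upwards [eventually_ge_atTop a] with S hS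
  have hS0 : 0 < S := ha.trans_le hS
  have hsm := cutoffPower_contDiffOn ((n : ℝ) / 2 - m) S
  have hz := cutoffPower_eq_zero ((n : ℝ) / 2 - m) hS0
  have huI : Integrable fun x => u x *
      (radialOp n a)^[m] (cutoffPower ((n : ℝ) / 2 - m) S) (a + ‖x - c‖ ^ 2) :=
    hu.locallyIntegrable.integrable_mul_radial ha c (hsm.radialOp_iterate n a m)
      (radialOp_iterate_eq_zero hz n a m)
  rw [← hu.weak_eq_radial ha c hsm hz, ← integral_sub huI hηI, ← integral_const_mul,
    ← integral_add (hηI.indicator (hDm S)) ((huB S).const_mul _)]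
  refine norm_integral_le_of_norm_le ((hηI.indicator (hDm S)).add ((huB S).const_mul _)) ?_
  filter_upwards [hu.nonneg] with x hx
  have hτ : 0 < a + ‖x - c‖ ^ 2 := by positivity
  have hη0 : 0 ≤ η x := by positivity
  have hind : 0 ≤ C * S ^ (-((n : ℝ) / 2)) * (B S).indicator u x :=
    mul_nonneg (by positivity) (indicator_apply_nonneg fun _ => hx)
  rw [Real.norm_eq_abs]
  rcases lt_or_ge (a + ‖x - c‖ ^ 2) S with h1 | h1
  · rw [radialOp_iterate_cutoffPower_of_lt n m a hτ h1,
      indicator_of_notMem (show x ∉ D S from not_le.2 h1), zero_add]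
    refine le_trans (le_of_eq ?_) hind
    rw [abs_eq_zero, hη]
    ring
  rw [indicator_of_mem (show x ∈ D S from h1)]
  rcases lt_or_ge (2 * S) (a + ‖x - c‖ ^ 2) with h2 | h2
  · rw [radialOp_iterate_eq_zero hz n a m _ h2, mul_zero, zero_sub, abs_neg, abs_of_nonneg hη0]
    linarith
  · have hxB : x ∈ B S := by
      rw [hB, mem_closedBall_iff_norm]
      exact Real.le_sqrt_of_sq_le (by linarith)
    rw [indicator_of_mem hxB]
    have := hbd a S _ ha hS h1 h2
    refine (abs_sub _ _).trans ?_
    rw [abs_of_nonneg hη0, abs_mul, abs_of_nonneg hx, add_comm]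
    rw [add_le_add_iff_left, mul_comm]
    exact mul_le_mul_of_nonneg_right this hx

/-- The truncated bubbles increase with the cutoff scale, so monotone convergence applies with no
prior finiteness of the source integral. -/
theorem IsDistributionalSolution.lintegral_source_mul_bubble
    (hu : IsDistributionalSolution n m σ p u) (hm : 1 ≤ m) (hn : 2 * m < n) (hp : 1 < p)
    (hσ : -(2 * (m : ℝ)) < σ) {a : ℝ} (ha : 0 < a) (c : EuclideanSpace ℝ (Fin n))
    (hint : Integrable fun x => u x * (a + ‖x - c‖ ^ 2) ^ (-((n : ℝ) / 2 + m))) :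
    ∫⁻ x, ENNReal.ofReal (henonSource n σ p u x * (a + ‖x - c‖ ^ 2) ^ (-((n : ℝ) / 2 - m))) =
      ENNReal.ofReal (bubbleConst n m * a ^ m) *
        ∫⁻ x, ENNReal.ofReal (u x * (a + ‖x - c‖ ^ 2) ^ (-((n : ℝ) / 2 + m))) := by
  have hc := bubbleConst_pos hn
  set s : ℝ := (n : ℝ) / 2 - m with hs
  have hτ : ∀ x : EuclideanSpace ℝ (Fin n), 0 < a + ‖x - c‖ ^ 2 := fun x => by positivity
  have hS : ∀ k : ℕ, (0 : ℝ) < k + 1 := fun k => by positivity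
  have hI : ∀ k : ℕ, Integrable fun x =>
      henonSource n σ p u x * cutoffPower s (k + 1) (a + ‖x - c‖ ^ 2) := fun k =>
    hu.locallyIntegrable_source.integrable_mul_radial ha c (cutoffPower_contDiffOn s _)
      (cutoffPower_eq_zero s (hS k))
  have hk : Tendsto (fun k : ℕ => (k : ℝ) + 1) atTop atTop :=
    tendsto_atTop_add_const_right _ _ tendsto_natCast_atTop_atTop
  have h1 := ENNReal.tendsto_ofReal
    ((hu.tendsto_integral_source_cutoffPower hm hn hp hσ ha c hint).comp hk)
  rw [integral_const_mul, ENNReal.ofReal_mul (by positivity),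
    ofReal_integral_eq_lintegral_ofReal hint (by
      filter_upwards [hu.nonneg] with x hx
      have := hτ x
      simp only [Pi.zero_apply]
      positivity)] at h1
  refine tendsto_nhds_unique ?_ h1
  have h2 : Tendsto (fun k : ℕ => ∫⁻ x, ENNReal.ofReal
      (henonSource n σ p u x * cutoffPower s (k + 1) (a + ‖x - c‖ ^ 2))) atTop
      (𝓝 (∫⁻ x, ENNReal.ofReal (henonSource n σ p u x * (a + ‖x - c‖ ^ 2) ^ (-s)))) := by
    refine lintegral_tendsto_of_tendsto_of_monotone
      (fun k => (hI k).aestronglyMeasurable.aemeasurable.ennreal_ofReal) ?_ ?_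
    · filter_upwards [hu.source_nonneg] with x hx
      intro k l hkl
      refine ENNReal.ofReal_le_ofReal (mul_le_mul_of_nonneg_left ?_ hx)
      exact cutoffPower_mono s (hS k) (by gcongr) (hτ x)
    · refine Eventually.of_forall fun x => tendsto_const_nhds.congr' ?_
      filter_upwards [hk.eventually_ge_atTop (a + ‖x - c‖ ^ 2)] with k hkx
      rw [cutoffPower_of_le s (hS k) hkx]
  refine h2.congr fun k => ?_
  rw [Function.comp_apply, ofReal_integral_eq_lintegral_ofReal (hI k)]
  filter_upwards [hu.source_nonneg] with x hx
  exact mul_nonneg hx (cutoffPower_nonneg s _ (hτ x))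
end

/-! ### Limit `ε → 0` and the representation formula. -/

section
variable {n m : ℕ} {σ p : ℝ} {u : EuclideanSpace ℝ (Fin n) → ℝ}

theorem MeasureTheory.LocallyIntegrable.withDensity_ofReal_closedBall
    (hu : LocallyIntegrable u) (h0 : ∀ᵐ x, 0 ≤ u x) (c : EuclideanSpace ℝ (Fin n)) (r : ℝ) :
    (volume.withDensity fun x => ENNReal.ofReal (u x)) (Metric.closedBall c r) =
      ENNReal.ofReal (∫ x in Metric.closedBall c r, u x) := by
  rw [withDensity_apply _ measurableSet_closedBall, ofReal_integral_eq_lintegral_ofReal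
    (hu.integrableOn_isCompact (isCompact_closedBall _ _)) (ae_restrict_of_ae h0)]

theorem MeasureTheory.LocallyIntegrable.isLocallyFiniteMeasure_withDensity_ofReal
    (hu : LocallyIntegrable u) (h0 : ∀ᵐ x, 0 ≤ u x) :
    IsLocallyFiniteMeasure (volume.withDensity fun x => ENNReal.ofReal (u x)) :=
  ⟨fun x => ⟨Metric.closedBall x 1, Metric.closedBall_mem_nhds x one_pos, by
    rw [hu.withDensity_ofReal_closedBall h0]
    exact ENNReal.ofReal_lt_top⟩⟩

theorem MeasureTheory.LocallyIntegrable.ae_tendsto_withDensity_closedBall_div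
    (hu : LocallyIntegrable u) (h0 : ∀ᵐ x, 0 ≤ u x) :
    ∀ᵐ c, Tendsto (fun r => (volume.withDensity fun x => ENNReal.ofReal (u x))
      (Metric.closedBall c r) / volume (Metric.closedBall c r)) (𝓝[>] 0)
      (𝓝 (ENNReal.ofReal (u c))) := by
  have := hu.isLocallyFiniteMeasure_withDensity_ofReal h0
  have hm : AEMeasurable (fun x => ENNReal.ofReal (u x)) :=
    hu.aestronglyMeasurable.aemeasurable.ennreal_ofReal
  filter_upwards [Besicovitch.ae_tendsto_rnDeriv
    (volume.withDensity fun x => ENNReal.ofReal (u x)) volume,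
    Measure.rnDeriv_withDensity₀ volume hm] with c h1 h2
  rwa [h2] at h1

/-- Puts the image of the bubble with `a = ε²` into the form `ε^(-n)` times a dilated fixed profile,
as required for the approximate identity. -/
theorem mul_lintegral_bubble_eq (hu : AEMeasurable u) (h0 : ∀ᵐ x, 0 ≤ u x) {ε : ℝ}
    (hε : 0 < ε) {k : ℝ} (hk : 0 ≤ k) (c : EuclideanSpace ℝ (Fin n)) :
    ENNReal.ofReal (k * (ε ^ 2) ^ m) *
        ∫⁻ x, ENNReal.ofReal (u x * (ε ^ 2 + ‖x - c‖ ^ 2) ^ (-((n : ℝ) / 2 + m))) =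
      ENNReal.ofReal k * ((ENNReal.ofReal (ε ^ n))⁻¹ *
        ∫⁻ x, ENNReal.ofReal ((1 + ‖x - c‖ ^ 2 / ε ^ 2) ^ (-((n : ℝ) / 2 + m)))
          ∂(volume.withDensity fun x => ENNReal.ofReal (u x))) := by
  rw [lintegral_withDensity_eq_lintegral_mul₀ hu.ennreal_ofReal
    (Measurable.aemeasurable (by fun_prop)), ← ENNReal.ofReal_inv_of_pos (by positivity),
    ← lintegral_const_mul' _ _ ENNReal.ofReal_ne_top, ← lintegral_const_mul' _ _
    ENNReal.ofReal_ne_top, ← lintegral_const_mul' _ _ ENNReal.ofReal_ne_top]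
  refine lintegral_congr_ae ?_
  filter_upwards [h0] with x hx
  rw [Pi.mul_apply, ← ENNReal.ofReal_mul (by positivity), ← ENNReal.ofReal_mul hx,
    ← ENNReal.ofReal_mul (by positivity), ← ENNReal.ofReal_mul hk]
  congr 1
  have e1 : ε ^ 2 + ‖x - c‖ ^ 2 = ε ^ 2 * (1 + ‖x - c‖ ^ 2 / ε ^ 2) := by field_simp
  have e2 : (ε ^ 2) ^ (-((n : ℝ) / 2 + m)) = (ε ^ n)⁻¹ / (ε ^ 2) ^ m := by
    rw [neg_add, ← sub_eq_add_neg, Real.rpow_sub_natCast (by positivity),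
      ← Real.rpow_natCast_mul hε.le, ← Real.rpow_natCast ε n, ← Real.rpow_neg hε.le]
    congr 2
    push_cast
    ring
  rw [e1, Real.mul_rpow (by positivity) (by positivity), e2]
  field_simp

theorem tendsto_lintegral_source_bubble {f : EuclideanSpace ℝ (Fin n) → ℝ} (hn : 2 * m < n)
    (hf : AEMeasurable f) (h0 : ∀ᵐ x, 0 ≤ f x) (c : EuclideanSpace ℝ (Fin n)) {ε : ℕ → ℝ}
    (hε : ∀ k, 0 < ε k) (hanti : Antitone ε) (hε0 : Tendsto ε atTop (𝓝 0)) :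
    Tendsto (fun k => ∫⁻ x, ENNReal.ofReal
        (f x * (ε k ^ 2 + ‖x - c‖ ^ 2) ^ (-((n : ℝ) / 2 - m)))) atTop
      (𝓝 (∫⁻ x, ENNReal.ofReal (f x / ‖c - x‖ ^ ((n : ℝ) - 2 * m)))) := by
  have hn' : 2 * (m : ℝ) < n := by exact_mod_cast hn
  have : Nonempty (Fin n) := Fin.pos_iff_nonempty.1 (by omega)
  have hne : ∀ᵐ x : EuclideanSpace ℝ (Fin n), x ≠ c :=
    measure_eq_zero_iff_ae_notMem.1 (measure_singleton c)
  refine lintegral_tendsto_of_tendsto_of_monotone (fun k => ?_) ?_ ?_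
  · have : Measurable fun x : EuclideanSpace ℝ (Fin n) =>
        (ε k ^ 2 + ‖x - c‖ ^ 2) ^ (-((n : ℝ) / 2 - m)) := by fun_prop
    exact (hf.mul this.aemeasurable).ennreal_ofReal
  · filter_upwards [h0] with x hx
    intro k l hkl
    have h1 := hε l
    have h2 := hanti hkl
    refine ENNReal.ofReal_le_ofReal (mul_le_mul_of_nonneg_left ?_ hx)
    refine Real.rpow_le_rpow_of_nonpos (by positivity) (by gcongr) (by linarith)
  · filter_upwards [hne] with x hx
    have hd : 0 < ‖x - c‖ := norm_sub_pos_iff.2 hx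
    have h1 : Tendsto (fun k => ε k ^ 2 + ‖x - c‖ ^ 2) atTop (𝓝 (‖x - c‖ ^ 2)) := by
      simpa using (hε0.pow 2).add_const (‖x - c‖ ^ 2)
    have h2 := (h1.rpow_const (p := -((n : ℝ) / 2 - m)) (Or.inl (by positivity))).const_mul (f x)
    have e : f x / ‖c - x‖ ^ ((n : ℝ) - 2 * m) =
        f x * (‖x - c‖ ^ 2) ^ (-((n : ℝ) / 2 - m)) := by
      rw [norm_sub_rev c x, div_eq_mul_inv, ← Real.rpow_neg hd.le, ← Real.rpow_natCast_mul hd.le]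
      congr 2
      push_cast
      ring
    rw [e]
    exact ENNReal.tendsto_ofReal h2

end

theorem mainTheorem4 (n m : ℕ) (hm : 1 ≤ m) (hn : 2 * m < n) (σ p : ℝ)
    (hσ : -(2 * (m : ℝ)) < σ) (hp : 1 < p)
    (u : EuclideanSpace ℝ (Fin n) → ℝ) (hu : IsDistributionalSolution n m σ p u) :
    ∀ᵐ x : EuclideanSpace ℝ (Fin n),
      Integrable (fun y : EuclideanSpace ℝ (Fin n) =>
        ‖y‖ ^ σ * u y ^ p / ‖x - y‖ ^ ((n : ℝ) - 2 * m)) ∧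
      u x = rieszConst n (2 * m) *
        ∫ y : EuclideanSpace ℝ (Fin n),
          ‖y‖ ^ σ * u y ^ p / ‖x - y‖ ^ ((n : ℝ) - 2 * m) := by
  have hn0 : n ≠ 0 := by omega
  have hn' : 2 * (m : ℝ) < n := by exact_mod_cast hn
  have hm' : (0 : ℝ) < m := by exact_mod_cast hm
  have hc := bubbleConst_pos hn
  have hum := hu.locallyIntegrable.aestronglyMeasurable.aemeasurable
  have hfm := hu.locallyIntegrable_source.aestronglyMeasurable.aemeasurable
  set ε : ℕ → ℝ := fun k => 1 / ((k : ℝ) + 1) with hε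
  have hεpos : ∀ k, 0 < ε k := fun k => Nat.one_div_pos_of_nat
  have hε0 : Tendsto ε atTop (𝓝 0) := tendsto_one_div_add_atTop_nhds_zero_nat
  have hεa : Antitone ε := fun k l hkl => Nat.one_div_le_one_div hkl
  have hb : (n : ℝ) / 2 < (n : ℝ) / 2 + m := by linarith
  set J : ℝ := Real.pi ^ ((n : ℝ) / 2) * Real.Gamma ((n : ℝ) / 2 + m - (n : ℝ) / 2) /
    Real.Gamma ((n : ℝ) / 2 + m) with hJ
  have hJ0 : 0 ≤ J := by
    have h1 : 0 < Real.Gamma ((n : ℝ) / 2 + m - (n : ℝ) / 2) :=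
      Real.Gamma_pos_of_pos (by linarith)
    have h2 : 0 < Real.Gamma ((n : ℝ) / 2 + m) := Real.Gamma_pos_of_pos (by positivity)
    positivity
  filter_upwards [hu.locallyIntegrable.ae_tendsto_withDensity_closedBall_div hu.nonneg, hu.nonneg]
    with c hleb huc
  set ν := volume.withDensity fun x => ENNReal.ofReal (u x) with hν
  have hinf : ∀ᶠ r : ℝ in atTop, ν (Metric.closedBall c r) ≤ ENNReal.ofReal (r ^ n) := by
    filter_upwards [(hu.tendsto_setIntegral_closedBall_div hm hn0 hp hσ c).eventually_lt_const
      one_pos, eventually_gt_atTop 0] with r hr hr0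
    rw [hν, hu.locallyIntegrable.withDensity_ofReal_closedBall hu.nonneg]
    exact ENNReal.ofReal_le_ofReal ((div_lt_one (by positivity)).1 hr).le
  obtain ⟨M, hM, hgrow⟩ := exists_measure_closedBall_le ENNReal.ofReal_ne_top hleb hinf
  have hlim := tendsto_lintegral_bubble hn0 hb hM hgrow hleb hεpos hε0
  rw [lintegral_one_add_norm_sq_rpow_neg n hb, ← hJ, ← ENNReal.ofReal_mul huc] at hlim
  have hR := ENNReal.Tendsto.const_mul (a := ENNReal.ofReal (bubbleConst n m)) hlim
    (Or.inr ENNReal.ofReal_ne_top)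
  rw [← ENNReal.ofReal_mul hc.le] at hR
  have hL := tendsto_lintegral_source_bubble hn hfm hu.source_nonneg c hεpos hεa hε0
  have hkey : ∫⁻ y, ENNReal.ofReal (henonSource n σ p u y / ‖c - y‖ ^ ((n : ℝ) - 2 * m)) =
      ENNReal.ofReal (bubbleConst n m * (u c * J)) := by
    refine tendsto_nhds_unique (hL.congr' ?_) hR
    -- The limit is finite, so the integrals are finite for large `k`; this supplies the
    -- integrability needed for the bubble identity.
    filter_upwards [hR.eventually_ne ENNReal.ofReal_ne_top] with k hk
    have e := mul_lintegral_bubble_eq (m := m) hum hu.nonneg (hεpos k) hc.le c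
    have hεk := hεpos k
    rw [← hν] at e
    rw [← e] at hk ⊢
    refine hu.lintegral_source_mul_bubble hm hn hp hσ (by positivity) c ?_
    have hmeas : Measurable fun x : EuclideanSpace ℝ (Fin n) =>
        (ε k ^ 2 + ‖x - c‖ ^ 2) ^ (-((n : ℝ) / 2 + m)) := by fun_prop
    refine (lintegral_ofReal_ne_top_iff_integrable
      (hum.mul hmeas.aemeasurable).aestronglyMeasurable ?_).1 fun htop => hk ?_
    · filter_upwards [hu.nonneg] with x hx
      simp only [Pi.zero_apply, Pi.mul_apply]
      positivity
    · change (∫⁻ x, ENNReal.ofReal (u x * (ε k ^ 2 + ‖x - c‖ ^ 2) ^ (-((n : ℝ) / 2 + m)))) = ⊤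
        at htop
      rw [htop, ENNReal.mul_top (ENNReal.ofReal_pos.2 (by positivity)).ne']
  have hmeas : Measurable fun y : EuclideanSpace ℝ (Fin n) => ‖c - y‖ ^ ((n : ℝ) - 2 * m) := by
    fun_prop
  have hnn : 0 ≤ᵐ[volume] fun y => henonSource n σ p u y / ‖c - y‖ ^ ((n : ℝ) - 2 * m) := by
    filter_upwards [hu.source_nonneg] with y hy
    simp only [Pi.zero_apply]
    positivity
  have hI : Integrable fun y => henonSource n σ p u y / ‖c - y‖ ^ ((n : ℝ) - 2 * m) :=
    (lintegral_ofReal_ne_top_iff_integrable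
      (hfm.div hmeas.aemeasurable).aestronglyMeasurable hnn).1
      (by
        change (∫⁻ y, ENNReal.ofReal
          (henonSource n σ p u y / ‖c - y‖ ^ ((n : ℝ) - 2 * m))) ≠ ⊤
        rw [hkey]; exact ENNReal.ofReal_ne_top)
  refine ⟨hI, ?_⟩
  have hval : ∫ y, henonSource n σ p u y / ‖c - y‖ ^ ((n : ℝ) - 2 * m) =
      bubbleConst n m * (u c * J) := by
    rw [← ofReal_integral_eq_lintegral_ofReal hI hnn] at hkey
    exact (ENNReal.ofReal_eq_ofReal_iff (integral_nonneg_of_ae hnn) (by positivity)).1 hkey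
  change u c = rieszConst n (2 * m) *
    ∫ y, henonSource n σ p u y / ‖c - y‖ ^ ((n : ℝ) - 2 * m)
  rw [hval]
  linear_combination (-u c) * rieszConst_mul_bubbleConst hm hn
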